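/- Let $\mathbb{F}_q$ be a finite field, $A=\mathbb{F}_q[\theta]$, $K_\infty=\mathbb{F}_q((1/\theta))$ with $|\theta|=q$, and let $\mathbb{C}_\infty$ be the completion of an algebraic closure of $K_\infty$. Let $\mathbb{C}_\infty[[\tau]]$ be the ring of twisted power series, $\tau c=c^q\tau$, and $\mathbb{C}_\infty[\tau]$ its subring of polynomials. For $i\in\mathbb{Z}$ write $c^{(i)}=c^{q^i}$ for $c\in\mathbb{C}_\infty$, and extend this coefficientwise to power series in $t$ and entrywise to matrices. Let $\mathbb{T}$ be the Tate algebra of all $\sum a_it^i\in\mathbb{C}_\infty[[t]]$ with $a_i\to0$, with the Gauss norm. Let $r\ge1$ and let $\phi:A\to\mathbb{C}_\infty[\tau]$ be the Drinfeld module with $\phi_\theta=\theta+k_1\tau+\dots+k_r\tau^r$, where $|k_i|\le1$ for $1\le i<r$ and $k_r\in\mathbb{F}_q^\times$. Let $\exp_\phi=\sum_{n\ge0} Q_n\tau^n$ be the unique series with $Q_0=1$ and $\exp_\phi\,\theta=\phi_\theta\exp_\phi$, and let $\log_\phi=\sum_{n\ge0}\beta_n\tau^n$ be its inverse in $\mathbb{C}_\infty[[\tau]]$;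 write $\exp_\phi(z)=\sum_n Q_nz^{q^n}$ and $\log_\phi(z)=\sum_n\beta_nz^{q^n}$. *Periods.* Let $\xi_1,\dots,\xi_r$ be an $\mathbb{F}_q$-basis of $\phi[\theta]=\{z\in\mathbb{C}_\infty:\phi_\theta(z)=0\}$. The $\xi_i$ lie in the domain of convergence of $\log_\phi$; put $\lambda_i=\theta\log_\phi(\xi_i)$ (the fundamental periods) and $\overline\pi=(\lambda_1,\dots,\lambda_r)$. *Trivialization.* Put $f_j=\sum_{i\ge0}\exp_\phi(\lambda_j/\theta^{i+1})t^i$ and $\Upsilon=(f_j^{(i-1)})_{1\le i,j\le r}$. Let $V\in\mathrm{GL}_r(\mathbb{C}_\infty)$ be the matrix with $(i,j)$ entry $k_{i+j-1}^{(1-j)}$ if $i+j-1\le r$ and $0$ otherwise, and let $\Psi=V^{-1}((\Upsilon^{(1)})^{\mathrm{tr}})^{-1}$. *The map $\mathcal{M}$.* Let $\Phi$ be the $r\times r$ matrix over $\mathbb{C}_\infty[t]$ with $\Phi_{i,i+1}=1$ for $1\le i<r$, last row $\bigl(\tfrac{t-\theta}{k_r^{(-r)}},-\tfrac{k_1^{(-1)}}{k_r^{(-r)}},\dots,-\tfrac{k_{r-1}^{(-(r-1))}}{k_r^{(-r)}}\bigr)$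 and all other entries $0$, and put $[f_{1,n},\dots,f_{r,n}]=[0,\dots,0,1]\,(\Phi^{\mathrm{tr}})^{(n-1)}\cdots(\Phi^{\mathrm{tr}})^{(1)}\Phi^{\mathrm{tr}}$. Let $\mathfrak{v}=q^{q^{r-1}/(q^r-1)}$, and let $\mathbb{M}$ be the space of all $\sum a_n\tau^n$ with $|a_n|\mathfrak{v}^{q^n}\to0$, normed by $\max_n|a_n|\mathfrak{v}^{q^n}$. Define $\tilde\varphi:\mathbb{C}_\infty[\tau]\to\mathrm{Mat}_{1\times r}(\mathbb{C}_\infty[t])$ by $\tilde\varphi(\sum a_n\tau^n)=\sum_n k_r^{-1}a_n[f_{1,n},\dots,f_{r,n}]$, and define $\varphi:\mathbb{M}\to\mathrm{Mat}_{1\times r}(\mathbb{T})$ by $\varphi(\sum a_n\tau^n)=\lim_{N\to\infty}\tilde\varphi(\sum_{n<N}a_n\tau^n)$. **Theorem.** We have $\Upsilon\in\mathrm{GL}_r(\mathbb{T})$, and $\varphi$ is a continuous injective extension of $\tilde\varphi$; let $\mathcal{M}=\varphi^{-1}$ be its inverse, defined on the image of $\varphi$. The vector $-\frac{1}{t-\theta}\,\overline\pi\,(\Psi^{\mathrm{tr}})^{(-1)}$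 has entries in $\mathbb{T}$ and lies in the image of $\varphi$, and $$\log_\phi=\mathcal{M}\Bigl(-\frac{1}{t-\theta}\,\overline\pi\,(\Psi^{\mathrm{tr}})^{(-1)}\Bigr).$$ Moreover, for $z\in\mathbb{C}_\infty$ let $\delta_{1,z}(\sum a_n\tau^n)=\lim_{m\to\infty}\sum_{n\le m}a_nz^{q^n}$, defined on the series with $a_nz^{q^n}\to0$, and let $\mathcal{M}_z=\delta_{1,z}\circ\varphi^{-1}$. Then for every $z$ in the domain of convergence of $\log_\phi$, the series $\mathcal{M}\bigl(-\frac{1}{t-\theta}\overline\pi(\Psi^{\mathrm{tr}})^{(-1)}\bigr)$ lies in the domain of $\delta_{1,z}$ and $$\log_\phi(z)=\mathcal{M}_z\Bigl(-\frac{1}{t-\theta}\,\overline\pi\,(\Psi^{\mathrm{tr}})^{(-1)}\Bigr).$$ -/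

import Mathlib

open Filter Topology
open scoped NNReal Matrix Polynomial PowerSeries

noncomputable section

namespace DrinfeldLog

/-! ### The field `C_∞` -/

section Fields

variable (Fq : Type*) [Field Fq] [Fintype Fq]

open Classical in
/-- `K_∞ = F_q((1/θ))`: the completion of `K = F_q(θ)` at its infinite place. -/
def KInfty : Type _ := RatFunc.CompletionAtInfty Fq

open Classical in
instance : Field (KInfty Fq) := inferInstanceAs (Field (RatFunc.CompletionAtInfty Fq))

open Classical in
instance KInfty.valued : Valued (KInfty Fq) (WithZero (Multiplicative ℤ)) :=
  inferInstanceAs (Valued (RatFunc.CompletionAtInfty Fq) _)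

open Classical in
instance : Algebra (RatFunc Fq) (KInfty Fq) :=
  inferInstanceAs (Algebra (RatFunc Fq) (RatFunc.CompletionAtInfty Fq))

open Classical in
instance : CompleteSpace (KInfty Fq) := by
  let _ : UniformSpace (RatFunc Fq) := (RatFunc.inftyValued Fq).toUniformSpace
  exact inferInstanceAs (CompleteSpace (UniformSpace.Completion (RatFunc Fq)))

open Classical in
theorem KInfty.valued_algebraMap (x : RatFunc Fq) :
    Valued.v (algebraMap (RatFunc Fq) (KInfty Fq) x) = RatFunc.inftyValuation Fq x := by
  let _ : Valued (RatFunc Fq) _ := RatFunc.inftyValued Fq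
  exact Valued.extensionValuation_apply_coe x

theorem one_lt_card : (1 : ℝ≥0) < Fintype.card Fq := by
  exact_mod_cast Fintype.one_lt_card

/-- The valuation of `K_∞` is made real valued by `exp n ↦ q ^ n`, so that `|θ| = q`. -/
instance KInfty.rankOne : (KInfty.valued Fq).v.RankOne where
  hom' := (WithZeroMulInt.toNNReal (one_lt_card Fq).ne_zero).comp
    MonoidWithZeroHom.ValueGroup₀.embedding
  strictMono' := (WithZeroMulInt.toNNReal_strictMono (one_lt_card Fq)).comp
    MonoidWithZeroHom.ValueGroup₀.embedding_strictMono
  exists_val_nontrivial := by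
    classical
    refine ⟨algebraMap (RatFunc Fq) (KInfty Fq) RatFunc.X, ?_⟩
    rw [KInfty.valued_algebraMap, RatFunc.inftyValuation.X]
    exact ⟨by simp, by simp⟩

instance : NontriviallyNormedField (KInfty Fq) :=
  Valued.toNontriviallyNormedField (KInfty Fq) (WithZero (Multiplicative ℤ))

instance : IsUltrametricDist (KInfty Fq) :=
  Valued.instIsUltrametricDist (KInfty Fq) (WithZero (Multiplicative ℤ))

open Classical in
theorem KInfty.norm_algebraMap (x : RatFunc Fq) :
    ‖algebraMap (RatFunc Fq) (KInfty Fq) x‖ =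
      WithZeroMulInt.toNNReal (one_lt_card Fq).ne_zero (RatFunc.inftyValuation Fq x) := by
  rw [← KInfty.valued_algebraMap]
  change ((WithZeroMulInt.toNNReal (one_lt_card Fq).ne_zero)
    (MonoidWithZeroHom.ValueGroup₀.embedding
      ((KInfty.valued Fq).v.restrict (algebraMap (RatFunc Fq) (KInfty Fq) x))) : ℝ) = _
  rw [(KInfty.valued Fq).v.embedding_restrict]

/-- A fixed algebraic closure of `K_∞`, with the unique extension of the absolute value. -/
def KInftyAlg : Type _ := AlgebraicClosure (KInfty Fq)

instance : Field (KInftyAlg Fq) := inferInstanceAs (Field (AlgebraicClosure (KInfty Fq)))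

instance : Algebra (KInfty Fq) (KInftyAlg Fq) :=
  inferInstanceAs (Algebra (KInfty Fq) (AlgebraicClosure (KInfty Fq)))

instance : IsAlgClosed (KInftyAlg Fq) :=
  inferInstanceAs (IsAlgClosed (AlgebraicClosure (KInfty Fq)))

instance : Algebra.IsAlgebraic (KInfty Fq) (KInftyAlg Fq) :=
  inferInstanceAs (Algebra.IsAlgebraic (KInfty Fq) (AlgebraicClosure (KInfty Fq)))

instance : NormedField (KInftyAlg Fq) := spectralNorm.normedField (KInfty Fq) (KInftyAlg Fq)

instance : IsUltrametricDist (KInftyAlg Fq) :=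
  IsUltrametricDist.isUltrametricDist_of_forall_norm_add_le_max_norm
    (isNonarchimedean_spectralNorm (K := KInfty Fq) (L := KInftyAlg Fq))

/-- `C_∞`: the completion of an algebraic closure of `K_∞`. -/
def CInfty : Type _ := UniformSpace.Completion (KInftyAlg Fq)

instance : NormedField (CInfty Fq) :=
  inferInstanceAs (NormedField (UniformSpace.Completion (KInftyAlg Fq)))

instance : CompleteSpace (CInfty Fq) :=
  inferInstanceAs (CompleteSpace (UniformSpace.Completion (KInftyAlg Fq)))

/-- The embedding of `K = F_q(θ)` into `C_∞`. -/
def fromK : RatFunc Fq →+* CInfty Fq :=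
  (UniformSpace.Completion.coeRingHom (α := KInftyAlg Fq)).comp
    ((algebraMap (KInfty Fq) (KInftyAlg Fq)).comp (algebraMap (RatFunc Fq) (KInfty Fq)))

instance : Algebra Fq (CInfty Fq) := ((fromK Fq).comp RatFunc.C).toAlgebra

/-- The element `θ` of `C_∞`. -/
def theta : CInfty Fq := fromK Fq RatFunc.X

open Classical in
theorem norm_fromK (x : RatFunc Fq) : ‖fromK Fq x‖ =
    WithZeroMulInt.toNNReal (one_lt_card Fq).ne_zero (RatFunc.inftyValuation Fq x) := by
  rw [← KInfty.norm_algebraMap]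
  refine (UniformSpace.Completion.norm_coe (E := KInftyAlg Fq) _).trans ?_
  exact spectralNorm_extends (K := KInfty Fq) (L := KInftyAlg Fq) _

theorem norm_theta : ‖theta Fq‖ = Fintype.card Fq := by
  classical
  rw [theta, norm_fromK, RatFunc.inftyValuation.X]
  rw [WithZeroMulInt.toNNReal_neg_apply _ (by simp)]
  have h : Multiplicative.toAdd (WithZero.unzero (x := WithZero.exp (1 : ℤ)) (by simp)) = 1 := rfl
  rw [h]
  simp

instance : IsUltrametricDist (CInfty Fq) := by
  refine IsUltrametricDist.isUltrametricDist_of_forall_norm_add_le_max_norm fun x y => ?_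
  refine UniformSpace.Completion.induction_on₂ (α := KInftyAlg Fq) (β := KInftyAlg Fq)
    (p := fun x y : CInfty Fq => ‖x + y‖ ≤ max ‖x‖ ‖y‖) x y ?_ ?_
  · exact isClosed_le (by fun_prop) (by fun_prop)
  · intro a b
    have h := IsUltrametricDist.norm_add_le_max a b
    have e (c : KInftyAlg Fq) : ‖(show CInfty Fq from (c : UniformSpace.Completion _))‖ = ‖c‖ :=
      UniformSpace.Completion.norm_coe c
    have e2 : (show CInfty Fq from (a : UniformSpace.Completion _)) +
      (show CInfty Fq from (b : UniformSpace.Completion _)) =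
      (show CInfty Fq from ((a + b : KInftyAlg Fq) : UniformSpace.Completion _)) :=
      (UniformSpace.Completion.coe_add a b).symm
    exact (congrArg norm e2).trans_le ((e _).trans_le (h.trans_eq (by rw [← e a, ← e b])))

theorem exists_pow_card_eq (x : CInfty Fq) : ∃ y : CInfty Fq, y ^ Fintype.card Fq = x := by
  have hq : 1 < Fintype.card Fq := Fintype.one_lt_card
  have hsub (a b : CInfty Fq) :
      (a - b) ^ Fintype.card Fq = a ^ Fintype.card Fq - b ^ Fintype.card Fq :=
    map_sub (FiniteField.frobeniusAlgHom Fq (CInfty Fq)) a b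
  have hd : DenseRange fun y : KInftyAlg Fq =>
      (show CInfty Fq from (y : UniformSpace.Completion (KInftyAlg Fq))) :=
    UniformSpace.Completion.denseRange_coe
  have hroot (a : KInftyAlg Fq) : ∃ y : CInfty Fq,
      y ^ Fintype.card Fq = (show CInfty Fq from (a : UniformSpace.Completion (KInftyAlg Fq))) := by
    obtain ⟨z, hz⟩ := IsAlgClosed.exists_pow_nat_eq a (n := Fintype.card Fq) (by omega)
    refine ⟨(show CInfty Fq from (z : UniformSpace.Completion (KInftyAlg Fq))), ?_⟩
    rw [← hz]
    exact ((UniformSpace.Completion.coeRingHom (α := KInftyAlg Fq)).map_pow z _).symm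
  obtain ⟨u, hu, hlim⟩ := mem_closure_iff_seq_limit.1 (hd x)
  choose w hw using fun n => (show ∃ w : CInfty Fq, w ^ Fintype.card Fq = u n by
    obtain ⟨a, ha⟩ := hu n
    obtain ⟨w, hw⟩ := hroot a
    exact ⟨w, hw.trans ha⟩)
  have hc : CauchySeq w := by
    rw [Metric.cauchySeq_iff]
    intro ε hε
    obtain ⟨N, hN⟩ := Metric.cauchySeq_iff.1 hlim.cauchySeq (ε ^ Fintype.card Fq) (by positivity)
    refine ⟨N, fun m hm n hn => ?_⟩
    have h := hN m hm n hn
    rw [dist_eq_norm, ← hw, ← hw, ← hsub, norm_pow] at h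
    rw [dist_eq_norm]
    exact lt_of_pow_lt_pow_left₀ _ hε.le h
  obtain ⟨z, hz⟩ := cauchySeq_tendsto_of_complete hc
  refine ⟨z, tendsto_nhds_unique (hz.pow (Fintype.card Fq)) ?_⟩
  simpa only [hw] using hlim

/-- The `q`-power Frobenius automorphism of `C_∞`. -/
def frob : RingAut (CInfty Fq) :=
  RingEquiv.ofBijective (FiniteField.frobeniusAlgHom Fq (CInfty Fq)).toRingHom
    ⟨RingHom.injective _, fun x => exists_pow_card_eq Fq x⟩

theorem frob_apply (x : CInfty Fq) : frob Fq x = x ^ Fintype.card Fq := rfl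

theorem frob_pow_apply (n : ℕ) (x : CInfty Fq) :
    (frob Fq ^ n) x = x ^ Fintype.card Fq ^ n := by
  induction n with
  | zero => simp
  | succ n ih => rw [pow_succ', RingAut.mul_apply, ih, frob_apply, ← pow_mul, pow_succ]

end Fields

/-! ### Twisted power series -/

/-- The set `C_∞[[τ]]`; the series `∑ aₙ τⁿ` is the sequence `n ↦ aₙ`. -/
def TauSeries (Fq : Type*) [Field Fq] [Fintype Fq] : Type _ := ℕ → CInfty Fq

section TauSeries

variable {Fq : Type*} [Field Fq] [Fintype Fq]

namespace TauSeries

instance addCommGroup : AddCommGroup (TauSeries Fq) := inferInstanceAs (AddCommGroup (ℕ → CInfty Fq))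

instance : Module (CInfty Fq) (TauSeries Fq) :=
  inferInstanceAs (Module (CInfty Fq) (ℕ → CInfty Fq))

/-- The coefficient of `τⁿ`. -/
def coeff (n : ℕ) (a : TauSeries Fq) : CInfty Fq := a n

@[ext]
theorem ext {a b : TauSeries Fq} (h : ∀ n, coeff n a = coeff n b) : a = b := funext h

@[simp]
theorem coeff_zero (n : ℕ) : coeff n (0 : TauSeries Fq) = 0 := rfl

@[simp]
theorem coeff_add (n : ℕ) (a b : TauSeries Fq) : coeff n (a + b) = coeff n a + coeff n b := rfl

@[simp]
theorem coeff_smul (n : ℕ) (c : CInfty Fq) (a : TauSeries Fq) :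
    coeff n (c • a) = c * coeff n a := rfl

/-- The constant series `c τ⁰`. -/
def const (c : CInfty Fq) : TauSeries Fq := fun n => if n = 0 then c else 0

@[simp]
theorem coeff_const (n : ℕ) (c : CInfty Fq) : coeff n (const c) = if n = 0 then c else 0 := rfl

instance : One (TauSeries Fq) := ⟨const 1⟩

theorem coeff_one (n : ℕ) : coeff n (1 : TauSeries Fq) = if n = 0 then 1 else 0 := rfl

/-- Multiplication, determined by `τ c = c ^ q τ`. -/
instance : Mul (TauSeries Fq) :=
  ⟨fun a b n => ∑ p ∈ Finset.HasAntidiagonal.antidiagonal n, coeff p.1 a * (frob Fq ^ p.1) (coeff p.2 b)⟩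

theorem coeff_mul (n : ℕ) (a b : TauSeries Fq) : coeff n (a * b) =
    ∑ p ∈ Finset.HasAntidiagonal.antidiagonal n, coeff p.1 a * (frob Fq ^ p.1) (coeff p.2 b) := rfl

theorem const_mul_eq (c : CInfty Fq) (a : TauSeries Fq) : const c * a = c • a := by
  ext n
  rw [coeff_mul, Finset.sum_eq_single (0, n)]
  · simp
  · rintro ⟨i, j⟩ h hne
    have : i ≠ 0 := by
      rintro rfl
      simp_all
    simp [this]
  · simp

theorem coeff_mul_const (n : ℕ) (a : TauSeries Fq) (c : CInfty Fq) :
    coeff n (a * const c) = coeff n a * (frob Fq ^ n) c := by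
  rw [coeff_mul, Finset.sum_eq_single (n, 0)]
  · simp
  · rintro ⟨i, j⟩ h hne
    have : j ≠ 0 := by
      rintro rfl
      simp_all
    simp [this]
  · simp

protected theorem mul_assoc (a b c : TauSeries Fq) : a * b * c = a * (b * c) := by
  ext n
  simp only [coeff_mul, Finset.sum_mul, Finset.mul_sum, Finset.sum_sigma', map_sum, map_mul]
  refine Finset.sum_nbij' (fun x => ⟨(x.2.1, x.2.2 + x.1.2), (x.2.2, x.1.2)⟩)
    (fun x => ⟨(x.1.1 + x.2.1, x.2.2), (x.1.1, x.2.1)⟩) ?_ ?_ ?_ ?_ ?_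
  · rintro ⟨⟨i, j⟩, ⟨k, l⟩⟩ h
    simp only [Finset.mem_sigma, Finset.HasAntidiagonal.mem_antidiagonal, and_true] at h ⊢
    omega
  · rintro ⟨⟨i, j⟩, ⟨k, l⟩⟩ h
    simp only [Finset.mem_sigma, Finset.HasAntidiagonal.mem_antidiagonal, and_true] at h ⊢
    omega
  · rintro ⟨⟨i, j⟩, ⟨k, l⟩⟩ h
    simp only [Finset.mem_sigma, Finset.HasAntidiagonal.mem_antidiagonal] at h
    obtain ⟨-, rfl⟩ := h
    rfl
  · rintro ⟨⟨i, j⟩, ⟨k, l⟩⟩ h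
    simp only [Finset.mem_sigma, Finset.HasAntidiagonal.mem_antidiagonal] at h
    obtain ⟨-, rfl⟩ := h
    rfl
  · rintro ⟨⟨i, j⟩, ⟨k, l⟩⟩ h
    simp only [Finset.mem_sigma, Finset.HasAntidiagonal.mem_antidiagonal] at h
    obtain ⟨-, rfl⟩ := h
    simp only [pow_add, RingAut.mul_apply, mul_assoc]

instance : Ring (TauSeries Fq) where
  __ := addCommGroup
  mul_assoc := TauSeries.mul_assoc
  one_mul a := (const_mul_eq 1 a).trans (one_smul _ a)
  mul_one a := by
    ext n
    exact (coeff_mul_const n a 1).trans (by simp)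
  zero_mul a := by ext n; simp [coeff_mul]
  mul_zero a := by ext n; simp [coeff_mul]
  left_distrib a b c := by ext n; simp [coeff_mul, mul_add, Finset.sum_add_distrib]
  right_distrib a b c := by ext n; simp [coeff_mul, add_mul, Finset.sum_add_distrib]

/-- The inclusion of constants as a ring homomorphism. -/
def constHom : CInfty Fq →+* TauSeries Fq where
  toFun := const
  map_one' := rfl
  map_mul' a b := by
    rw [const_mul_eq]
    ext n
    by_cases h : n = 0 <;> simp [h]
  map_zero' := by
    ext n
    simp
  map_add' a b := by
    ext n
    by_cases h : n = 0 <;> simp [h]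

theorem frob_algebraMap (c : Fq) : frob Fq (algebraMap Fq (CInfty Fq) c) = algebraMap Fq _ c := by
  rw [frob_apply, ← map_pow, FiniteField.pow_card]

theorem frob_pow_algebraMap (n : ℕ) (c : Fq) :
    (frob Fq ^ n) (algebraMap Fq (CInfty Fq) c) = algebraMap Fq _ c := by
  induction n with
  | zero => rfl
  | succ n ih => rw [pow_succ, RingAut.mul_apply, frob_algebraMap, ih]

instance : Algebra Fq (TauSeries Fq) :=
  (constHom.comp (algebraMap Fq (CInfty Fq))).toAlgebra' fun c a => by
    ext n
    change coeff n (const (algebraMap Fq _ c) * a) = coeff n (a * const (algebraMap Fq _ c))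
    rw [const_mul_eq, coeff_mul_const, frob_pow_algebraMap, coeff_smul, mul_comm]

/-- The truncation `∑_{n < N} aₙ τⁿ`. -/
def trunc (N : ℕ) (a : TauSeries Fq) : TauSeries Fq := fun n => if n < N then coeff n a else 0

theorem isUnit_of_coeff_zero (a : TauSeries Fq) (h : coeff 0 a = 1) : IsUnit a := by
  have key : ∀ a : TauSeries Fq, coeff 0 a = 1 → ∃ b : TauSeries Fq, coeff 0 b = 1 ∧ b * a = 1 := by
    intro a h
    have hx : ∃ b : TauSeries Fq, ∀ n, b n = if n = 0 then 1 else
        -∑ i ∈ (Finset.range n).attach, b i.1 * (frob Fq ^ i.1) (coeff (n - i.1) a) := by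
      let F : (n : ℕ) → ((m : ℕ) → m < n → CInfty Fq) → CInfty Fq := fun n rec =>
        if n = 0 then 1 else -∑ i ∈ (Finset.range n).attach,
          rec i.1 (Finset.mem_range.1 i.2) * (frob Fq ^ i.1) (coeff (n - i.1) a)
      refine ⟨fun n => Nat.lt_wfRel.wf.fix F n, fun n => ?_⟩
      exact Nat.lt_wfRel.wf.fix_eq F n
    obtain ⟨b, hb⟩ := hx
    refine ⟨b, hb 0, ?_⟩
    ext n
    rw [coeff_mul, Finset.Nat.sum_antidiagonal_eq_sum_range_succ_mk, Finset.sum_range_succ]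
    simp only [Nat.sub_self, h, map_one, mul_one, coeff_one]
    change _ + b n = _
    rw [hb n, Finset.sum_attach (Finset.range n)
      (fun i => b i * (frob Fq ^ i) (coeff (n - i) a))]
    by_cases hn : n = 0
    · simp [hn]
    · simp only [hn, if_false]
      exact add_neg_cancel _
  obtain ⟨b, hb, hba⟩ := key a h
  obtain ⟨c, -, hcb⟩ := key b hb
  have hca : c = a := by rw [← mul_one c, ← hba, ← mul_assoc, hcb, one_mul]
  exact ⟨⟨a, b, hca ▸ hcb, hba⟩, rfl⟩

end TauSeries

/-- `∑ aₙ z^(qⁿ)`, the value at `z` of the `F_q`-linear power series attached to `∑ aₙ τⁿ`. -/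
def evalAt (a : TauSeries Fq) (z : CInfty Fq) : CInfty Fq :=
  ∑' n, a.coeff n * z ^ Fintype.card Fq ^ n

end TauSeries

/-! ### Drinfeld modules, exponential and logarithm -/

section Drinfeld

variable {Fq : Type*} [Field Fq] [Fintype Fq]

/-- The polynomial `θ + k₁ τ + ⋯ + k_r τ^r`; only the values `k 1, …, k r` are used. -/
def phiTheta (r : ℕ) (k : ℕ → CInfty Fq) : TauSeries Fq :=
  fun n => if n = 0 then theta Fq else if n ≤ r then k n else 0

/-- The Drinfeld module `φ : A = F_q[θ] → C_∞[τ]` with `φ_θ = θ + k₁ τ + ⋯ + k_r τ^r`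
(here `Polynomial.X` plays the role of `θ ∈ A`). -/
def drinfeld (r : ℕ) (k : ℕ → CInfty Fq) : Fq[X] →ₐ[Fq] TauSeries Fq :=
  Polynomial.aeval (phiTheta r k)

theorem drinfeld_X (r : ℕ) (k : ℕ → CInfty Fq) : drinfeld r k Polynomial.X = phiTheta r k :=
  Polynomial.aeval_X _

theorem theta_pow_sub_ne_zero (n : ℕ) (hn : n ≠ 0) : (frob Fq ^ n) (theta Fq) - theta Fq ≠ 0 := by
  intro h
  have hq : 1 < Fintype.card Fq := Fintype.one_lt_card
  have h1 := congrArg norm (sub_eq_zero.1 h)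
  rw [frob_pow_apply, norm_pow, norm_theta] at h1
  have h2 : Fintype.card Fq ^ (Fintype.card Fq ^ n) = Fintype.card Fq := by exact_mod_cast h1
  have h3 : Fintype.card Fq ^ n = 1 := Nat.pow_right_injective hq (by simpa using h2)
  have h4 : 1 < Fintype.card Fq ^ n := Nat.one_lt_pow hn hq
  omega

/-- There is exactly one series `exp_φ = ∑ Qₙ τⁿ` with `Q₀ = 1` and `exp_φ θ = φ_θ exp_φ`. -/
theorem existsUnique_exp (r : ℕ) (k : ℕ → CInfty Fq) : ∃! E : TauSeries Fq,
    E.coeff 0 = 1 ∧ E * TauSeries.const (theta Fq) = drinfeld r k Polynomial.X * E := by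
  have hx : ∃ b : TauSeries Fq, ∀ n, b n = if n = 0 then 1 else
      ((frob Fq ^ n) (theta Fq) - theta Fq)⁻¹ * ∑ i ∈ (Finset.range n).attach,
        phiTheta r k (i.1 + 1) * (frob Fq ^ (i.1 + 1)) (b (n - (i.1 + 1))) := by
    let F : (n : ℕ) → ((m : ℕ) → m < n → CInfty Fq) → CInfty Fq := fun n rec =>
      if n = 0 then 1 else
        ((frob Fq ^ n) (theta Fq) - theta Fq)⁻¹ * ∑ i ∈ (Finset.range n).attach,
          phiTheta r k (i.1 + 1) * (frob Fq ^ (i.1 + 1))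
            (rec (n - (i.1 + 1)) (by have := Finset.mem_range.1 i.2; omega))
    exact ⟨fun n => Nat.lt_wfRel.wf.fix F n, fun n => Nat.lt_wfRel.wf.fix_eq F n⟩
  have hchar (E : TauSeries Fq) :
      (E * TauSeries.const (theta Fq) = drinfeld r k Polynomial.X * E) ↔
      ∀ n, ((frob Fq ^ n) (theta Fq) - theta Fq) * E n = ∑ i ∈ Finset.range n,
        phiTheta r k (i + 1) * (frob Fq ^ (i + 1)) (E (n - (i + 1))) := by
    rw [TauSeries.ext_iff]
    refine forall_congr' fun n => ?_
    rw [TauSeries.coeff_mul_const, TauSeries.coeff_mul,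
      Finset.Nat.sum_antidiagonal_eq_sum_range_succ_mk, Finset.sum_range_succ', drinfeld_X]
    have h0 : TauSeries.coeff 0 (phiTheta r k) = theta Fq := rfl
    simp only [h0, pow_zero, RingAut.one_apply, Nat.sub_zero, sub_mul]
    rw [sub_eq_iff_eq_add, mul_comm]
    rfl
  obtain ⟨b, hb⟩ := hx
  refine ⟨b, ⟨hb 0, (hchar b).2 fun n => ?_⟩, ?_⟩
  · rcases eq_or_ne n 0 with rfl | hn
    · simp
    · rw [hb n, if_neg hn, mul_inv_cancel_left₀ (theta_pow_sub_ne_zero n hn),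
        Finset.sum_attach (Finset.range n)
          fun i => phiTheta r k (i + 1) * (frob Fq ^ (i + 1)) (b (n - (i + 1)))]
  · rintro E ⟨h0, hE⟩
    rw [hchar] at hE
    ext n
    induction n using Nat.strong_induction_on with
    | _ n ih =>
      rcases eq_or_ne n 0 with rfl | hn
      · exact h0.trans (hb 0).symm
      · change E n = b n
        rw [hb n, if_neg hn, eq_inv_mul_iff_mul_eq₀ (theta_pow_sub_ne_zero n hn), hE n,
          Finset.sum_attach (Finset.range n)
            fun i => phiTheta r k (i + 1) * (frob Fq ^ (i + 1)) (b (n - (i + 1)))]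
        refine Finset.sum_congr rfl fun i hi => ?_
        have := Finset.mem_range.1 hi
        have h := ih (n - (i + 1)) (by omega)
        change E _ = b _ at h
        rw [h]

/-- The exponential series `exp_φ` of the Drinfeld module. -/
def expSeries (r : ℕ) (k : ℕ → CInfty Fq) : TauSeries Fq := (existsUnique_exp r k).choose

/-- The logarithm series `log_φ`, the inverse of `exp_φ` in `C_∞[[τ]]`. -/
def logSeries (r : ℕ) (k : ℕ → CInfty Fq) : TauSeries Fq := Ring.inverse (expSeries r k)

theorem isUnit_expSeries (r : ℕ) (k : ℕ → CInfty Fq) : IsUnit (expSeries r k) :=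
  TauSeries.isUnit_of_coeff_zero _ (existsUnique_exp r k).choose_spec.1.1

end Drinfeld
/-! ### The Tate algebra `𝕋` and the space `𝕄` -/

section Spaces

variable (Fq : Type*) [Field Fq] [Fintype Fq]

/-- The Tate algebra `𝕋` of power series in `t` over `C_∞` whose coefficients tend to `0`. -/
abbrev Tate : Type _ := ↥(PowerSeries.IsRestricted.subring (R := CInfty Fq) 1)

variable {Fq}

theorem Tate.hasGaussNorm (f : Tate Fq) :
    PowerSeries.HasGaussNorm (norm : CInfty Fq → ℝ) 1 (f : (CInfty Fq)⟦X⟧) :=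
  ((PowerSeries.isRestricted_iff' 1 (f : (CInfty Fq)⟦X⟧)).1 f.2).bddAbove_range

/-- The Gauss norm on `𝕋`. -/
instance : NormedAddCommGroup (Tate Fq) := AddGroupNorm.toNormedAddCommGroup
  { toFun := fun f => PowerSeries.gaussNorm (norm : CInfty Fq → ℝ) 1 (f : (CInfty Fq)⟦X⟧)
    map_zero' := PowerSeries.gaussNorm_zero _ _ norm_zero
    add_le' := fun f g => by
      refine (PowerSeries.gaussNorm_add_le_max (norm : CInfty Fq → ℝ) 1 _ _ zero_le_one
        norm_nonneg IsUltrametricDist.norm_add_le_max f.hasGaussNorm g.hasGaussNorm).trans ?_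
      exact max_le_add_of_nonneg (PowerSeries.gaussNorm_nonneg _ _ _ norm_nonneg)
        (PowerSeries.gaussNorm_nonneg _ _ _ norm_nonneg)
    neg' := fun f => by simp [PowerSeries.gaussNorm_eq]
    eq_zero_of_map_eq_zero' := fun f h => Subtype.ext
      ((PowerSeries.gaussNorm_eq_zero_iff (norm : CInfty Fq → ℝ) 1 _ norm_zero norm_nonneg
        (fun _ => norm_eq_zero.1) zero_lt_one f.hasGaussNorm).1 h) }

theorem Tate.norm_eq (f : Tate Fq) :
    ‖f‖ = ⨆ i : ℕ, ‖PowerSeries.coeff i (f : (CInfty Fq)⟦X⟧)‖ := by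
  change PowerSeries.gaussNorm (norm : CInfty Fq → ℝ) 1 (f : (CInfty Fq)⟦X⟧) = _
  simp [PowerSeries.gaussNorm_eq]

/-- A polynomial in `t`, as an element of `𝕋`. -/
def Tate.ofPolynomial (p : (CInfty Fq)[X]) : Tate Fq :=
  ⟨(p : (CInfty Fq)⟦X⟧), (PowerSeries.isRestricted_iff' 1 _).2 <| tendsto_const_nhds.congr' <| by
    filter_upwards [eventually_gt_atTop p.natDegree] with n hn
    simp [Polynomial.coeff_eq_zero_of_natDegree_lt hn]⟩

variable (Fq) in
/-- The real number `𝔳 = q ^ (q ^ (r - 1) / (q ^ r - 1))`. -/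
def frakV (r : ℕ) : ℝ :=
  (Fintype.card Fq : ℝ) ^ ((Fintype.card Fq : ℝ) ^ (r - 1) / ((Fintype.card Fq : ℝ) ^ r - 1))

theorem frakV_pos (r : ℕ) : 0 < frakV Fq r :=
  Real.rpow_pos_of_pos (by exact_mod_cast Fintype.card_pos) _

variable (Fq) in
/-- The space `𝕄` of all `∑ aₙ τⁿ` such that `|aₙ| 𝔳 ^ (qⁿ) → 0`. -/
def MM (r : ℕ) : AddSubgroup (TauSeries Fq) where
  carrier := {a | Tendsto (fun n => ‖a.coeff n‖ * frakV Fq r ^ Fintype.card Fq ^ n) atTop (𝓝 0)}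
  zero_mem' := by simp
  add_mem' {a b} ha hb := by
    refine squeeze_zero (fun n => by have := frakV_pos (Fq := Fq) r; positivity) (fun n => ?_)
      (by simpa using ha.add hb)
    rw [← add_mul, TauSeries.coeff_add]
    have := frakV_pos (Fq := Fq) r
    gcongr
    exact norm_add_le _ _
  neg_mem' {a} ha := by
    have h (n : ℕ) : ‖(-a).coeff n‖ = ‖a.coeff n‖ := norm_neg (a.coeff n)
    simpa only [Set.mem_ofPred_eq, h] using ha

theorem MM.bddAbove {r : ℕ} (a : MM Fq r) :
    BddAbove (Set.range fun n => ‖a.1.coeff n‖ * frakV Fq r ^ Fintype.card Fq ^ n) :=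
  Tendsto.bddAbove_range a.2

theorem MM.iSup_nonneg {r : ℕ} (a : MM Fq r) :
    0 ≤ ⨆ n, ‖a.1.coeff n‖ * frakV Fq r ^ Fintype.card Fq ^ n :=
  Real.iSup_nonneg fun n => by have := frakV_pos (Fq := Fq) r; positivity

/-- The norm `|∑ aₙ τⁿ|_𝔳 = sup |aₙ| 𝔳 ^ (qⁿ)` on `𝕄`. -/
instance (r : ℕ) : NormedAddCommGroup (MM Fq r) := AddGroupNorm.toNormedAddCommGroup
  { toFun := fun a => ⨆ n, ‖a.1.coeff n‖ * frakV Fq r ^ Fintype.card Fq ^ n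
    map_zero' := by simp
    add_le' := fun a b => by
      refine ciSup_le fun n => ?_
      refine le_trans ?_ (add_le_add (le_ciSup (MM.bddAbove a) n) (le_ciSup (MM.bddAbove b) n))
      rw [← add_mul]
      have := frakV_pos (Fq := Fq) r
      gcongr
      exact norm_add_le (a.1.coeff n) (b.1.coeff n)
    neg' := fun a => iSup_congr fun n => by
      have h : ‖(-a.1).coeff n‖ = ‖a.1.coeff n‖ := norm_neg (a.1.coeff n)
      exact congrArg (· * _) h
    eq_zero_of_map_eq_zero' := fun a h => by
      refine Subtype.ext (TauSeries.ext fun n => ?_)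
      have h1 : ‖a.1.coeff n‖ * frakV Fq r ^ Fintype.card Fq ^ n ≤ 0 :=
        (le_ciSup (MM.bddAbove a) n).trans_eq h
      have h2 : 0 < frakV Fq r ^ Fintype.card Fq ^ n := pow_pos (frakV_pos r) _
      exact norm_le_zero_iff.1 (nonpos_of_mul_nonpos_left h1 h2) }

theorem MM.norm_eq {r : ℕ} (a : MM Fq r) :
    ‖a‖ = ⨆ n, ‖a.1.coeff n‖ * frakV Fq r ^ Fintype.card Fq ^ n := rfl

/-- The truncation `∑_{n < N} aₙ τⁿ` of an element of `𝕄`. -/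
def MM.trunc {r : ℕ} (N : ℕ) (a : MM Fq r) : MM Fq r :=
  ⟨a.1.trunc N, tendsto_const_nhds.congr' <| by
    filter_upwards [eventually_ge_atTop N] with n hn
    have h : (a.1.trunc N).coeff n = 0 := if_neg (by omega)
    simp [h]⟩

variable (Fq) in
/-- The subset `M_φ = C_∞[τ]` of `𝕄`. -/
def Mphi (r : ℕ) : Set (MM Fq r) := {a | ∃ N, ∀ n ≥ N, a.1.coeff n = 0}

end Spaces

/-! ### Twists -/

section Twists

variable {Fq : Type*} [Field Fq] [Fintype Fq]

/-- The twist `c ↦ c^{(i)} = c ^ (q ^ i)` on `C_∞`, for `i ∈ ℤ`. -/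
def twist (i : ℤ) : CInfty Fq →+* CInfty Fq := ((frob Fq ^ i : RingAut (CInfty Fq)) : _ →+* _)

/-- The coefficientwise twist `f ↦ f^{(i)}` on `C_∞[[t]]`. -/
def twistPS (i : ℤ) : (CInfty Fq)⟦X⟧ →+* (CInfty Fq)⟦X⟧ := PowerSeries.map (twist i)

end Twists

section Main

variable {Fq : Type*} [Field Fq] [Fintype Fq]

/-! ### The map `φ : 𝕄 → Mat_{1 × r}(𝕋)` and its inverse -/

/-- The matrix `Φ`: the entries above the diagonal are `1`, the last row is
`((t - θ) / k_r^{(-r)}, -k_1^{(-1)} / k_r^{(-r)}, …, -k_{r-1}^{(-(r-1))} / k_r^{(-r)})`,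
and the other entries are `0`. Rows and columns are numbered from `0`. -/
def PhiMat (r : ℕ) (k : ℕ → CInfty Fq) : Matrix (Fin r) (Fin r) (CInfty Fq)[X] :=
  Matrix.of fun i j =>
    if i.1 + 1 < r then (if j.1 = i.1 + 1 then 1 else 0)
    else if j.1 = 0 then
      Polynomial.C (twist (-(r : ℤ)) (k r))⁻¹ * (Polynomial.X - Polynomial.C (theta Fq))
    else Polynomial.C (-(twist (-(j.1 : ℤ)) (k j.1)) / twist (-(r : ℤ)) (k r))

/-- The product `(Φᵗʳ)^{(n-1)} ⋯ (Φᵗʳ)^{(1)} Φᵗʳ`. -/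
def PhiProd (r : ℕ) (k : ℕ → CInfty Fq) : ℕ → Matrix (Fin r) (Fin r) (CInfty Fq)[X]
  | 0 => 1
  | n + 1 => (PhiMat r k)ᵀ.map (Polynomial.map (twist n)) * PhiProd r k n

/-- The row `[f_{1,n}, …, f_{r,n}]`, i.e. the last row of `(Φᵗʳ)^{(n-1)} ⋯ Φᵗʳ`. -/
def fRow (r : ℕ) (k : ℕ → CInfty Fq) (n : ℕ) : Fin r → (CInfty Fq)[X] := fun j =>
  ∑ i : Fin r, if i.1 + 1 = r then PhiProd r k n i j else 0

/-- The map `φ̃ : M_φ → Mat_{1 × r}(C_∞[t]) ⊆ Mat_{1 × r}(𝕋)`,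
`∑ aₙ τⁿ ↦ ∑ k_r⁻¹ aₙ [f_{1,n}, …, f_{r,n}]` (a finite sum on `M_φ`). -/
def phiTilde (r : ℕ) (k : ℕ → CInfty Fq) (a : MM Fq r) : Fin r → Tate Fq := fun j =>
  ∑ᶠ n : ℕ, Tate.ofPolynomial (Polynomial.C ((k r)⁻¹ * a.1.coeff n) * fRow r k n j)

/-- The map `φ : 𝕄 → Mat_{1 × r}(𝕋)`, the limit of `φ̃` along truncations. -/
def phiMap (r : ℕ) (k : ℕ → CInfty Fq) (a : MM Fq r) : Fin r → Tate Fq :=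
  limUnder atTop fun N : ℕ => phiTilde r k (MM.trunc N a)

/-- The map `𝓜 = φ⁻¹`. -/
def calM (r : ℕ) (k : ℕ → CInfty Fq) : (Fin r → Tate Fq) → MM Fq r :=
  Function.invFun (phiMap r k)

/-- The domain `M_z` of `δ_{1,z}`. -/
def domDelta (z : CInfty Fq) : Set (TauSeries Fq) :=
  {a | Tendsto (fun n => a.coeff n * z ^ Fintype.card Fq ^ n) atTop (𝓝 0)}

/-- The map `δ_{1,z}`. -/
def delta (z : CInfty Fq) (a : TauSeries Fq) : CInfty Fq :=
  limUnder atTop fun m : ℕ => ∑ n ∈ Finset.range (m + 1), a.coeff n * z ^ Fintype.card Fq ^ n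

/-- The map `𝓜_z = δ_{1,z} ∘ φ⁻¹`. -/
def calMz (r : ℕ) (k : ℕ → CInfty Fq) (z : CInfty Fq) (x : Fin r → Tate Fq) : CInfty Fq :=
  delta z (calM r k x)

/-! ### Periods and the rigid analytic trivialization -/

/-- The domain of convergence of `log_φ`. -/
def logDomain (r : ℕ) (k : ℕ → CInfty Fq) : Set (CInfty Fq) :=
  {z | Summable fun n => (logSeries r k).coeff n * z ^ Fintype.card Fq ^ n}

/-- The `F_q`-space `φ[θ]` of all `z` with `φ_θ(z) = 0`. -/
def thetaTorsion (r : ℕ) (k : ℕ → CInfty Fq) : Submodule Fq (CInfty Fq) where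
  carrier := {z | theta Fq * z + ∑ i ∈ Finset.Icc 1 r, k i * z ^ Fintype.card Fq ^ i = 0}
  zero_mem' := by simp
  add_mem' {a b} ha hb := by
    simp only [Set.mem_ofPred_eq, ← frob_pow_apply, map_add, mul_add,
      Finset.sum_add_distrib] at ha hb ⊢
    linear_combination ha + hb
  smul_mem' c a ha := by
    simp only [Set.mem_ofPred_eq, ← frob_pow_apply, Algebra.smul_def, map_mul,
      TauSeries.frob_pow_algebraMap, mul_left_comm _ (algebraMap Fq (CInfty Fq) c),
      ← Finset.mul_sum, ← mul_add] at ha ⊢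
    rw [ha, mul_zero]

/-- The fundamental period `λ = θ log_φ(ξ)` attached to `ξ ∈ φ[θ]`. -/
def fundPeriod (r : ℕ) (k : ℕ → CInfty Fq) (ξ : CInfty Fq) : CInfty Fq :=
  theta Fq * evalAt (logSeries r k) ξ

/-- The Anderson generating function `s_φ(z; t) = ∑ exp_φ(z / θ^(i+1)) tⁱ`. -/
def agf (r : ℕ) (k : ℕ → CInfty Fq) (z : CInfty Fq) : (CInfty Fq)⟦X⟧ :=
  PowerSeries.mk fun i => evalAt (expSeries r k) (z / theta Fq ^ (i + 1))

/-- The matrix `Υ` with entries `s_φ(λ_j; t)^{(i)}`, `0 ≤ i < r`. -/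
def Upsilon (r : ℕ) (k : ℕ → CInfty Fq) (lam : Fin r → CInfty Fq) :
    Matrix (Fin r) (Fin r) (CInfty Fq)⟦X⟧ :=
  Matrix.of fun i j => twistPS (i.1 : ℤ) (agf r k (lam j))

/-- The matrix `V`; in rows and columns numbered from `0`, its `(i, j)` entry is
`k_{i+j+1}^{(-j)}` if `i + j + 1 ≤ r` and `0` otherwise. -/
def VMat (r : ℕ) (k : ℕ → CInfty Fq) : Matrix (Fin r) (Fin r) (CInfty Fq) :=
  Matrix.of fun i j => if i.1 + j.1 + 1 ≤ r then twist (-(j.1 : ℤ)) (k (i.1 + j.1 + 1)) else 0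

/-- The matrix `Ψ = V⁻¹ ((Υ^{(1)})ᵗʳ)⁻¹`. -/
def Psi (r : ℕ) (k : ℕ → CInfty Fq) (lam : Fin r → CInfty Fq) :
    Matrix (Fin r) (Fin r) (CInfty Fq)⟦X⟧ :=
  ((VMat r k)⁻¹).map PowerSeries.C * (((Upsilon r k lam).map (twistPS 1))ᵀ)⁻¹

/-- The row vector `-(1 / (t - θ)) π̄ (Ψᵗʳ)^{(-1)}`, where `π̄ = (λ₁, …, λ_r)`. -/
def logVector (r : ℕ) (k : ℕ → CInfty Fq) (lam : Fin r → CInfty Fq) : Fin r → (CInfty Fq)⟦X⟧ :=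
  (-(PowerSeries.X - PowerSeries.C (theta Fq))⁻¹) •
    ((fun i => PowerSeries.C (lam i)) ᵥ* ((Psi r k lam)ᵀ.map (twistPS (-1))))

end Main

end DrinfeldLog

end

open Filter Topology
open scoped NNReal Matrix Polynomial PowerSeries

noncomputable section

namespace DrinfeldLog

variable {Fq : Type*} [Field Fq] [Fintype Fq]

local notation "qF" => Fintype.card Fq

/-! ### Radii -/

/-! Write s for `torsionRadius` and R = qs = s^(q^r) for `logRadius`. Since |k_i| ≤ 1, both exp_φ
and log_φ have coefficients of size at most R^(1 - qⁿ), so they are mutually inverse and norm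
preserving on |z| < R (`coeffBound_expSeries`, `CoeffBound.of_mul_eq_one`, `CoeffBound.evalAt_mul`).
A Newton polygon argument puts φ[θ] in |z| ≤ s < R. The coefficient d_i of tⁱ in an Anderson
generating function f is then exp_φ(log_φ(ξ)/θⁱ), it satisfies |d_i| ≤ s/qⁱ, and (t - θ) f = ∑ k_i
f^{(i)}.

Gauss norms are taken on the disc of radius q = |θ|. There det Υ is bounded by ∏ s^(q^i), exactly
the norm of its constant term, a Moore determinant; so Υ is invertible over 𝕋
(`norm_det_mooreMatrix`, `Tate.isUnit_of_dominant`). On the same disc f_{j,n} is bounded by s^(qⁿ)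
(`gaussBound_rowSeries`), so φ(a) converges up to t = θ. This gives injectivity: φ(a) = 0 forces a
relation u (t - θ) = -a₀, and u converges at θ, so a₀ = 0; then the remaining coefficients are
untwisted and the argument repeats (`phiMap_shift_eq_zero`).

For the formula, let h be the column of `adjointSeries` of f. By the functional equation Φᵗʳ carries
h to h^{(1)}, so the n-th row pairs with h to k_r f^{(n)} (`sum_rowSeries_mul_adjointSeries`). Hence
φ(log_φ) pairs with h to ∑ βₙ f^{(n)}, whose t^l coefficient is log_φ(d_l) = log_φ(ξ)/θ^l. This
geometric series is -λ/(t - θ). The columns h form the inverse of (Ψᵗʳ)^{(-1)} (`Psi_inverse`), so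
inverting them identifies φ(log_φ) with the stated vector, and injectivity does the rest. -/

theorem one_lt_card_real : (1 : ℝ) < qF := by exact_mod_cast Fintype.one_lt_card

theorem card_pow_pos (n : ℕ) : 0 < qF ^ n := pow_pos Fintype.card_pos n

theorem le_card_pow (n : ℕ) : n ≤ qF ^ n := (Nat.lt_pow_self Fintype.one_lt_card).le

variable (Fq) in
/-- The absolute value `q ^ (1 / (q ^ r - 1))` of the nonzero elements of `φ[θ]`. -/
def torsionRadius (r : ℕ) : ℝ := (qF : ℝ) ^ (1 / ((qF : ℝ) ^ r - 1))

variable (Fq) in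
/-- The radius `q ^ (q ^ r / (q ^ r - 1))` on which `exp_φ` and `log_φ` are inverse isometries. -/
def logRadius (r : ℕ) : ℝ := qF * torsionRadius Fq r

theorem card_pow_sub_one_pos {r : ℕ} (hr : 1 ≤ r) : (0 : ℝ) < (qF : ℝ) ^ r - 1 :=
  sub_pos.2 (one_lt_pow₀ one_lt_card_real (by omega))

theorem one_lt_torsionRadius {r : ℕ} (hr : 1 ≤ r) : 1 < torsionRadius Fq r :=
  Real.one_lt_rpow one_lt_card_real (one_div_pos.2 (card_pow_sub_one_pos hr))

theorem torsionRadius_pow_sub {r : ℕ} (hr : 1 ≤ r) : torsionRadius Fq r ^ (qF ^ r - 1) = qF := by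
  have h : ((qF ^ r - 1 : ℕ) : ℝ) = (qF : ℝ) ^ r - 1 := by
    rw [Nat.cast_sub (card_pow_pos r)]
    simp
  rw [torsionRadius, ← Real.rpow_natCast, ← Real.rpow_mul (by positivity), h,
    one_div_mul_cancel (card_pow_sub_one_pos hr).ne', Real.rpow_one]

/-- The balance |θz| = |z|^(q^r) at |z| = s, between the lowest and the highest term of φ_θ. Every
sharp estimate below rests on it. -/
theorem torsionRadius_pow {r : ℕ} (hr : 1 ≤ r) :
    torsionRadius Fq r ^ qF ^ r = logRadius Fq r := by
  rw [logRadius, ← torsionRadius_pow_sub hr, ← pow_succ, Nat.sub_add_cancel (card_pow_pos r)]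

theorem torsionRadius_lt_logRadius {r : ℕ} (hr : 1 ≤ r) :
    torsionRadius Fq r < logRadius Fq r := by
  have := one_lt_torsionRadius (Fq := Fq) hr
  have := one_lt_card_real (Fq := Fq)
  rw [logRadius]
  nlinarith

theorem one_lt_logRadius {r : ℕ} (hr : 1 ≤ r) : 1 < logRadius Fq r :=
  (one_lt_torsionRadius hr).trans (torsionRadius_lt_logRadius hr)

theorem frakV_eq (r : ℕ) : frakV Fq r = torsionRadius Fq r ^ qF ^ (r - 1) := by
  rw [torsionRadius, ← Real.rpow_natCast, ← Real.rpow_mul (by positivity), frakV]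
  congr 1
  push_cast
  ring

/-! ### Frobenius -/

theorem continuous_frob_pow (n : ℕ) : Continuous (frob Fq ^ n) := by
  have h : ⇑(frob Fq ^ n) = fun x => x ^ qF ^ n := funext (frob_pow_apply Fq n)
  rw [h]
  fun_prop

theorem norm_frob_pow (n : ℕ) (x : CInfty Fq) : ‖(frob Fq ^ n) x‖ = ‖x‖ ^ qF ^ n := by
  rw [frob_pow_apply, norm_pow]

theorem frob_pow_tsum {ι : Type*} (n : ℕ) {f : ι → CInfty Fq} (hf : Summable f) :
    (frob Fq ^ n) (∑' i, f i) = ∑' i, (frob Fq ^ n) (f i) :=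
  (hf.hasSum.map (frob Fq ^ n) (continuous_frob_pow n)).tsum_eq.symm

theorem twist_natCast (n : ℕ) (x : CInfty Fq) : twist (n : ℤ) x = (frob Fq ^ n) x := by
  simp [twist]

theorem twist_one (x : CInfty Fq) : twist 1 x = frob Fq x := by
  simp [twist]

theorem twist_twist (i j : ℤ) (x : CInfty Fq) : twist i (twist j x) = twist (i + j) x := by
  simp [twist, zpow_add]

theorem twist_zero (x : CInfty Fq) : twist 0 x = x := by simp [twist]

theorem twist_algebraMap (i : ℤ) (c : Fq) :
    twist i (algebraMap Fq (CInfty Fq) c) = algebraMap Fq _ c := by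
  rcases Int.eq_nat_or_neg i with ⟨n, rfl | rfl⟩
  · rw [twist_natCast, TauSeries.frob_pow_algebraMap]
  · nth_rw 1 [← TauSeries.frob_pow_algebraMap n c]
    rw [← twist_natCast, twist_twist, neg_add_cancel, twist_zero]

theorem norm_algebraMap_of_ne_zero {c : Fq} (hc : c ≠ 0) : ‖algebraMap Fq (CInfty Fq) c‖ = 1 := by
  have h : algebraMap Fq (CInfty Fq) c ^ (qF - 1) = 1 := by
    rw [← map_pow, FiniteField.pow_card_sub_one_eq_one c hc, map_one]
  have h2 := congrArg norm h
  rw [norm_pow, norm_one] at h2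
  have : 1 < qF := Fintype.one_lt_card
  exact (pow_eq_one_iff_of_nonneg (norm_nonneg _) (by omega)).1 h2

/-! ### Convergence and composition of twisted power series -/

theorem tsum_eq_tsum_sum_antidiagonal {α : Type*} [AddCommMonoid α] [TopologicalSpace α] [T3Space α]
    [ContinuousAdd α] {F : ℕ × ℕ → α} (hF : Summable F) :
    ∑' p, F p = ∑' n, ∑ p ∈ Finset.HasAntidiagonal.antidiagonal n, F p := by
  conv_rhs => congr; ext; rw [← Finset.sum_finset_coe, ← tsum_fintype (L := .unconditional _)]
  rw [← Finset.HasAntidiagonal.sigmaAntidiagonalEquivProd.tsum_eq F]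
  exact Summable.tsum_sigma' (fun n => (hasSum_fintype _).summable)
    (Finset.HasAntidiagonal.sigmaAntidiagonalEquivProd.summable_iff.2 hF)

/-- The coefficients satisfy `|aₙ| ≤ C R ^ (1 - qⁿ)`. -/
def CoeffBound (C R : ℝ) (a : TauSeries Fq) : Prop := ∀ n, ‖a.coeff n‖ * R ^ qF ^ n ≤ C * R

namespace CoeffBound

variable {C R : ℝ} {a b : TauSeries Fq} {z : CInfty Fq}

/-- Since R^(q^(i+j)) = (R^(q^j))^(q^i), the bound for b_j raised to the power q^i leaves R^(q^i),
which the bound for a_i absorbs. This needs constant 1 for the inner series only. -/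
theorem norm_mul_frob_le (hR : 0 < R) (ha : CoeffBound C R a) (hb : CoeffBound 1 R b) (i j : ℕ) :
    ‖a.coeff i * (frob Fq ^ i) (b.coeff j)‖ * R ^ qF ^ (i + j) ≤ C * R := by
  refine le_trans ?_ (ha i)
  rw [norm_mul, norm_frob_pow, pow_add, mul_comm (qF ^ i), pow_mul, mul_assoc, ← mul_pow]
  gcongr
  simpa using hb j

theorem norm_term_le (hR : 0 < R) (ha : CoeffBound C R a) (z : CInfty Fq) (n : ℕ) :
    ‖a.coeff n * z ^ qF ^ n‖ ≤ C * R * (‖z‖ / R) ^ qF ^ n := by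
  rw [norm_mul, norm_pow, div_pow, mul_div_assoc', le_div_iff₀ (by positivity), mul_right_comm]
  exact mul_le_mul_of_nonneg_right (ha n) (by positivity)

theorem nonneg (hR : 0 < R) (ha : CoeffBound C R a) : 0 ≤ C :=
  nonneg_of_mul_nonneg_left (le_trans (by positivity) (ha 0)) hR

theorem summable (hR : 0 < R) (ha : CoeffBound C R a) (hz : ‖z‖ < R) :
    Summable fun n => a.coeff n * z ^ qF ^ n := by
  have h1 : ‖z‖ / R < 1 := (div_lt_one hR).2 hz
  have h0 : 0 ≤ ‖z‖ / R := by positivity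
  refine Summable.of_norm_bounded
    ((summable_geometric_of_lt_one h0 h1).mul_left (C * R)) fun n => ?_
  have := ha.nonneg hR
  refine (ha.norm_term_le hR z n).trans ?_
  gcongr ?_ * ?_
  exact pow_le_pow_of_le_one h0 h1.le (le_card_pow n)

theorem norm_evalAt_le (hR : 0 < R) (ha : CoeffBound C R a) (hz : ‖z‖ < R) :
    ‖evalAt a z‖ ≤ C * ‖z‖ := by
  have h1 : ‖z‖ / R < 1 := (div_lt_one hR).2 hz
  have h0 : 0 ≤ ‖z‖ / R := by positivity
  have := ha.nonneg hR
  refine IsUltrametricDist.norm_tsum_le_of_forall_le_of_nonneg (by positivity) fun n => ?_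
  refine (ha.norm_term_le hR z n).trans ?_
  calc C * R * (‖z‖ / R) ^ qF ^ n ≤ C * R * (‖z‖ / R) := by
        gcongr
        exact pow_le_of_le_one h0 h1.le (card_pow_pos n).ne'
    _ = C * ‖z‖ := by field_simp

/-- Multiplication in `C_∞[[τ]]` is composition of the associated functions. -/
theorem evalAt_mul (hR : 0 < R) (ha : CoeffBound C R a) (hb : CoeffBound 1 R b) (hz : ‖z‖ < R) :
    evalAt (a * b) z = evalAt a (evalAt b z) := by
  have h1 : ‖z‖ / R < 1 := (div_lt_one hR).2 hz
  have h0 : 0 ≤ ‖z‖ / R := by positivity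
  have hC := ha.nonneg hR
  let F : ℕ × ℕ → CInfty Fq := fun p =>
    a.coeff p.1 * (frob Fq ^ p.1) (b.coeff p.2) * z ^ qF ^ (p.1 + p.2)
  have hF : Summable F := by
    have hg := summable_geometric_of_lt_one h0 h1
    refine Summable.of_norm_bounded
      ((hg.mul_of_nonneg hg (fun _ => by positivity) fun _ => by positivity).mul_left (C * R))
      fun p => ?_
    have h : ‖F p‖ ≤ C * R * (‖z‖ / R) ^ qF ^ (p.1 + p.2) := by
      rw [norm_mul, norm_pow, div_pow, mul_div_assoc', le_div_iff₀ (by positivity), mul_right_comm]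
      exact mul_le_mul_of_nonneg_right (norm_mul_frob_le hR ha hb p.1 p.2) (by positivity)
    refine h.trans ?_
    rw [← pow_add]
    gcongr ?_ * ?_
    exact pow_le_pow_of_le_one h0 h1.le (le_card_pow _)
  have hleft : evalAt (a * b) z = ∑' p, F p := by
    rw [tsum_eq_tsum_sum_antidiagonal hF]
    refine tsum_congr fun n => ?_
    rw [TauSeries.coeff_mul, Finset.sum_mul]
    refine Finset.sum_congr rfl fun p hp => ?_
    simp [F, Finset.HasAntidiagonal.mem_antidiagonal.1 hp]
  -- The double series summed along antidiagonals is the product series; summed along rows it is the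
  -- composition, because Frobenius is continuous and additive.
  rw [hleft, hF.tsum_prod]
  refine tsum_congr fun i => ?_
  rw [← frob_pow_apply, evalAt, frob_pow_tsum i (hb.summable hR hz), ← tsum_mul_left]
  refine tsum_congr fun j => ?_
  simp only [F, map_mul, map_pow, frob_pow_apply, ← pow_mul, pow_add, mul_assoc]

/-- As a₀ = 1, comparing coefficients of τⁿ in ba = 1 expresses bₙ through earlier b_i times twists
of a_{n-i}. The ultrametric inequality then propagates the bound with no loss. -/
theorem of_mul_eq_one (hR : 0 < R) (ha : CoeffBound 1 R a) (ha0 : a.coeff 0 = 1)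
    (hba : b * a = 1) : CoeffBound 1 R b := by
  intro n
  induction n using Nat.strong_induction_on with
  | _ n ih =>
  have h := congrArg (TauSeries.coeff n) hba
  rw [TauSeries.coeff_mul, Finset.Nat.sum_antidiagonal_eq_sum_range_succ_mk,
    Finset.sum_range_succ, TauSeries.coeff_one] at h
  simp only [Nat.sub_self, ha0, map_one, mul_one] at h
  rcases eq_or_ne n 0 with rfl | hn
  · simp_all
  rw [if_neg hn] at h
  rw [eq_neg_of_add_eq_zero_right h, norm_neg, ← le_div_iff₀ (by positivity)]
  refine IsUltrametricDist.norm_sum_le_of_forall_le_of_nonneg (by positivity) fun i hi => ?_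
  have hi := Finset.mem_range.1 hi
  rw [le_div_iff₀ (by positivity)]
  refine le_trans ?_ (ih i hi)
  rw [norm_mul, norm_frob_pow]
  obtain ⟨j, rfl⟩ := Nat.exists_eq_add_of_lt hi
  rw [show i + j + 1 - i = j + 1 by omega, add_assoc, pow_add, mul_comm (qF ^ i), pow_mul,
    mul_assoc, ← mul_pow]
  gcongr
  simpa using ha (j + 1)

end CoeffBound

/-! ### The exponential and the logarithm -/

section ExpLog

variable {r : ℕ} {k : ℕ → CInfty Fq}

theorem expSeries_coeff_zero : (expSeries r k).coeff 0 = 1 :=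
  (existsUnique_exp r k).choose_spec.1.1

theorem expSeries_mul_theta :
    expSeries r k * TauSeries.const (theta Fq) = phiTheta r k * expSeries r k := by
  have h : expSeries r k * TauSeries.const (theta Fq) = drinfeld r k Polynomial.X * expSeries r k :=
    (existsUnique_exp r k).choose_spec.1.2
  rwa [drinfeld_X] at h

theorem logSeries_mul_expSeries : logSeries r k * expSeries r k = 1 :=
  Ring.inverse_mul_cancel _ (isUnit_expSeries r k)

theorem expSeries_mul_logSeries : expSeries r k * logSeries r k = 1 :=
  Ring.mul_inverse_cancel _ (isUnit_expSeries r k)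

theorem coeff_phiTheta_of_pos {n : ℕ} (h0 : 1 ≤ n) (hn : n ≤ r) :
    (phiTheta r k).coeff n = k n := by
  simp [phiTheta, TauSeries.coeff, hn, show n ≠ 0 by omega]

theorem coeff_phiTheta_of_lt {n : ℕ} (hn : r < n) : (phiTheta r k).coeff n = 0 := by
  simp [phiTheta, TauSeries.coeff, hn, show n ≠ 0 by omega]

theorem norm_frob_theta_sub (n : ℕ) (hn : n ≠ 0) :
    ‖(frob Fq ^ n) (theta Fq) - theta Fq‖ = (qF : ℝ) ^ qF ^ n := by
  have h : ‖theta Fq‖ < ‖(frob Fq ^ n) (theta Fq)‖ := by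
    rw [norm_frob_pow, norm_theta]
    exact lt_self_pow₀ one_lt_card_real (Nat.one_lt_pow hn Fintype.one_lt_card)
  rw [sub_eq_add_neg, IsUltrametricDist.norm_add_eq_max_of_norm_ne_norm (by simpa using h.ne'),
    norm_neg, max_eq_left h.le, norm_frob_pow, norm_theta]

theorem expSeries_coeff_eq (n : ℕ) : ((frob Fq ^ n) (theta Fq) - theta Fq) *
    (expSeries r k).coeff n = ∑ i ∈ Finset.range n, (phiTheta r k).coeff (i + 1) *
      (frob Fq ^ (i + 1)) ((expSeries r k).coeff (n - (i + 1))) := by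
  have h := congrArg (TauSeries.coeff n) (expSeries_mul_theta (r := r) (k := k))
  rw [TauSeries.coeff_mul_const, TauSeries.coeff_mul,
    Finset.Nat.sum_antidiagonal_eq_sum_range_succ_mk, Finset.sum_range_succ'] at h
  have h0 : TauSeries.coeff 0 (phiTheta r k) = theta Fq := rfl
  simp only [h0, pow_zero, RingAut.one_apply, Nat.sub_zero] at h
  linear_combination h

/-- The recursion divides by θ^(qⁿ) - θ, a gain of q^(qⁿ). The term with k_i costs R^(q^i) = q^(q^i)
s^(q^i), and for i ≤ min(n, r) this is at most q^(qⁿ) s^(q^r) = q^(qⁿ) R. This is where the radius R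
comes from. -/
theorem coeffBound_expSeries (hr : 1 ≤ r) (hk : ∀ i, 1 ≤ i → i ≤ r → ‖k i‖ ≤ 1) :
    CoeffBound 1 (logRadius Fq r) (expSeries r k) := by
  have hR1 := one_lt_logRadius (Fq := Fq) hr
  have hR : 0 < logRadius Fq r := by linarith
  have hs1 := one_lt_torsionRadius (Fq := Fq) hr
  have hq := one_lt_card_real (Fq := Fq)
  intro n
  induction n using Nat.strong_induction_on with
  | _ n ih =>
  rcases eq_or_ne n 0 with rfl | hn
  · simp [expSeries_coeff_zero]
  have hkey : ‖(expSeries r k).coeff n‖ * (qF : ℝ) ^ qF ^ n ≤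
      logRadius Fq r * (qF : ℝ) ^ qF ^ n / logRadius Fq r ^ qF ^ n := by
    rw [← norm_frob_theta_sub n hn, mul_comm, ← norm_mul, expSeries_coeff_eq,
      norm_frob_theta_sub n hn]
    refine IsUltrametricDist.norm_sum_le_of_forall_le_of_nonneg (by positivity) fun i hi => ?_
    have hi := Finset.mem_range.1 hi
    rcases lt_or_ge r (i + 1) with hri | hri
    · rw [coeff_phiTheta_of_lt hri, zero_mul, norm_zero]
      positivity
    rw [coeff_phiTheta_of_pos (by omega) hri, norm_mul, norm_frob_pow]
    refine (mul_le_of_le_one_left (by positivity) (hk _ (by omega) hri)).trans ?_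
    rw [le_div_iff₀ (by positivity)]
    obtain ⟨j, rfl⟩ := Nat.exists_eq_add_of_lt hi
    have e : i + j + 1 = j + (i + 1) := by omega
    rw [show i + j + 1 - (i + 1) = j by omega, e, pow_add qF j, pow_mul (logRadius Fq r),
      ← mul_pow, ← pow_add]
    calc _ ≤ (logRadius Fq r) ^ qF ^ (i + 1) := by
          gcongr
          simpa using ih j (by omega)
      _ = (qF : ℝ) ^ qF ^ (i + 1) * torsionRadius Fq r ^ qF ^ (i + 1) := by
          rw [logRadius, mul_pow]
      _ ≤ (qF : ℝ) ^ qF ^ (j + (i + 1)) * torsionRadius Fq r ^ qF ^ r := by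
          have hq1 : 1 ≤ qF := Fintype.card_pos
          have h1 : qF ^ (i + 1) ≤ qF ^ (j + (i + 1)) := Nat.pow_le_pow_right hq1 (by omega)
          have h2 : qF ^ (i + 1) ≤ qF ^ r := Nat.pow_le_pow_right hq1 hri
          have := pow_le_pow_right₀ hq.le h1
          have := pow_le_pow_right₀ hs1.le h2
          gcongr
      _ = _ := by rw [torsionRadius_pow hr, mul_comm]
  rw [one_mul]
  rw [le_div_iff₀ (by positivity)] at hkey
  have h0 : (0 : ℝ) < (qF : ℝ) ^ qF ^ n := by positivity
  nlinarith

theorem coeffBound_logSeries (hr : 1 ≤ r) (hk : ∀ i, 1 ≤ i → i ≤ r → ‖k i‖ ≤ 1) :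
    CoeffBound 1 (logRadius Fq r) (logSeries r k) :=
  CoeffBound.of_mul_eq_one (zero_lt_one.trans (one_lt_logRadius hr)) (coeffBound_expSeries hr hk)
    expSeries_coeff_zero logSeries_mul_expSeries

theorem evalAt_one (z : CInfty Fq) : evalAt 1 z = z := by
  rw [evalAt, tsum_eq_single 0 fun n hn => by simp [TauSeries.coeff_one, hn]]
  simp [TauSeries.coeff_one]

theorem evalAt_phiTheta (z : CInfty Fq) : evalAt (phiTheta r k) z =
    theta Fq * z + ∑ i ∈ Finset.Icc 1 r, k i * z ^ qF ^ i := by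
  rw [evalAt, tsum_eq_sum (s := Finset.range (r + 1)) fun n hn => by
    rw [coeff_phiTheta_of_lt (by simpa using hn), zero_mul],
    Finset.sum_range_succ', add_comm, pow_zero, pow_one, Finset.range_eq_Ico,
    Finset.sum_Ico_add' (fun i => (phiTheta r k).coeff i * z ^ qF ^ i)]
  congr 1
  refine Finset.sum_congr (by ext; simp) fun i hi => ?_
  have hi := Finset.mem_Icc.1 hi
  rw [coeff_phiTheta_of_pos hi.1 hi.2]

theorem norm_evalAt_expSeries_le (hr : 1 ≤ r) (hk : ∀ i, 1 ≤ i → i ≤ r → ‖k i‖ ≤ 1)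
    {z : CInfty Fq} (hz : ‖z‖ < logRadius Fq r) :
    ‖evalAt (expSeries r k) z‖ ≤ ‖z‖ := by
  simpa using (coeffBound_expSeries hr hk).norm_evalAt_le
    (zero_lt_one.trans (one_lt_logRadius hr)) hz

theorem norm_evalAt_logSeries_le (hr : 1 ≤ r) (hk : ∀ i, 1 ≤ i → i ≤ r → ‖k i‖ ≤ 1)
    {z : CInfty Fq} (hz : ‖z‖ < logRadius Fq r) :
    ‖evalAt (logSeries r k) z‖ ≤ ‖z‖ := by
  simpa using (coeffBound_logSeries hr hk).norm_evalAt_le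
    (zero_lt_one.trans (one_lt_logRadius hr)) hz

theorem evalAt_exp_log (hr : 1 ≤ r) (hk : ∀ i, 1 ≤ i → i ≤ r → ‖k i‖ ≤ 1)
    {z : CInfty Fq} (hz : ‖z‖ < logRadius Fq r) :
    evalAt (expSeries r k) (evalAt (logSeries r k) z) = z := by
  rw [← CoeffBound.evalAt_mul (zero_lt_one.trans (one_lt_logRadius hr))
    (coeffBound_expSeries hr hk) (coeffBound_logSeries hr hk) hz, expSeries_mul_logSeries,
    evalAt_one]

theorem evalAt_log_exp (hr : 1 ≤ r) (hk : ∀ i, 1 ≤ i → i ≤ r → ‖k i‖ ≤ 1)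
    {z : CInfty Fq} (hz : ‖z‖ < logRadius Fq r) :
    evalAt (logSeries r k) (evalAt (expSeries r k) z) = z := by
  rw [← CoeffBound.evalAt_mul (zero_lt_one.trans (one_lt_logRadius hr))
    (coeffBound_logSeries hr hk) (coeffBound_expSeries hr hk) hz, logSeries_mul_expSeries,
    evalAt_one]

theorem evalAt_exp_theta_mul (hr : 1 ≤ r) (hk : ∀ i, 1 ≤ i → i ≤ r → ‖k i‖ ≤ 1)
    {z : CInfty Fq} (hz : ‖z‖ < logRadius Fq r) :
    evalAt (expSeries r k) (theta Fq * z) =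
    evalAt (phiTheta r k) (evalAt (expSeries r k) z) := by
  have hR := zero_lt_one.trans (one_lt_logRadius (Fq := Fq) hr)
  -- The outer factor of a composition may have any constant, and the polynomial φ_θ has one: the
  -- sum of its finitely many normalized coefficients.
  have hφ : ∃ C, CoeffBound C (logRadius Fq r) (phiTheta r k) := by
    refine ⟨∑ n ∈ Finset.range (r + 1),
      ‖(phiTheta r k).coeff n‖ * logRadius Fq r ^ qF ^ n / logRadius Fq r, fun n => ?_⟩
    rcases lt_or_ge r n with hn | hn
    · rw [coeff_phiTheta_of_lt hn, norm_zero, zero_mul]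
      positivity
    · rw [← div_le_iff₀ hR]
      exact Finset.single_le_sum (f := fun n => ‖(phiTheta r k).coeff n‖ *
        logRadius Fq r ^ qF ^ n / logRadius Fq r) (fun n _ => by positivity)
        (Finset.mem_range.2 (by omega))
  obtain ⟨C, hC⟩ := hφ
  rw [← CoeffBound.evalAt_mul hR hC (coeffBound_expSeries hr hk) hz, ← expSeries_mul_theta]
  refine tsum_congr fun n => ?_
  rw [TauSeries.coeff_mul_const, frob_pow_apply, mul_pow, mul_assoc]

end ExpLog

/-! ### Torsion points and Anderson generating functions -/

section Torsion

variable {r : ℕ} {k : ℕ → CInfty Fq}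

theorem theta_ne_zero : theta Fq ≠ 0 := by
  rw [← norm_pos_iff, norm_theta]
  exact_mod_cast Fintype.card_pos

theorem evalAt_phiTheta_of_mem {z : CInfty Fq} (hz : z ∈ thetaTorsion r k) :
    evalAt (phiTheta r k) z = 0 :=
  (evalAt_phiTheta z).trans hz

/-- If |z| > s > 1, then k_r z^(q^r) strictly dominates θz by the choice of s, and dominates the
middle terms because |k_i| ≤ 1. So φ_θ(z) could not vanish. -/
theorem norm_le_torsionRadius (hr : 1 ≤ r) (hk : ∀ i, 1 ≤ i → i ≤ r → ‖k i‖ ≤ 1)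
    (hkr : ‖k r‖ = 1) {z : CInfty Fq} (hz : z ∈ thetaTorsion r k) :
    ‖z‖ ≤ torsionRadius Fq r := by
  by_contra! hlt
  have hs1 := one_lt_torsionRadius (Fq := Fq) hr
  have hz1 : 1 < ‖z‖ := hs1.trans hlt
  have hq : (qF : ℝ) * ‖z‖ < ‖z‖ ^ qF ^ r := by
    obtain ⟨m, hm⟩ := Nat.exists_eq_add_of_lt (Nat.one_lt_pow (show r ≠ 0 by omega)
      (Fintype.one_lt_card (α := Fq)))
    have h := torsionRadius_pow_sub (Fq := Fq) hr
    rw [show qF ^ r - 1 = m + 1 by omega] at h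
    rw [hm, show 1 + m + 1 = (m + 1) + 1 by omega, pow_succ, ← h]
    gcongr
  obtain ⟨n, rfl⟩ := Nat.exists_eq_add_of_le' hr
  have hz0 := (evalAt_phiTheta z).symm.trans (evalAt_phiTheta_of_mem hz)
  rw [Finset.sum_Icc_succ_top (by omega), ← add_assoc] at hz0
  have hnorm : ‖z‖ ^ qF ^ (n + 1) = ‖theta Fq * z + ∑ i ∈ Finset.Icc 1 n, k i * z ^ qF ^ i‖ := by
    rw [← norm_neg (theta Fq * z + _), ← eq_neg_of_add_eq_zero_right hz0, norm_mul, hkr, one_mul,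
      norm_pow]
  have hle : ‖theta Fq * z + ∑ i ∈ Finset.Icc 1 n, k i * z ^ qF ^ i‖ ≤
      max (qF * ‖z‖) (‖z‖ ^ qF ^ n) := by
    refine (IsUltrametricDist.norm_add_le_max _ _).trans (max_le_max ?_ ?_)
    · rw [norm_mul, norm_theta]
    · refine IsUltrametricDist.norm_sum_le_of_forall_le_of_nonneg (by positivity) fun i hi => ?_
      have hi := Finset.mem_Icc.1 hi
      rw [norm_mul, norm_pow]
      refine (mul_le_of_le_one_left (by positivity) (hk i hi.1 (by omega))).trans ?_
      exact pow_le_pow_right₀ hz1.le (Nat.pow_le_pow_right Fintype.card_pos hi.2)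
  rw [← hnorm] at hle
  refine hle.not_gt (max_lt hq ?_)
  exact pow_lt_pow_right₀ hz1 (Nat.pow_lt_pow_right Fintype.one_lt_card (by omega))

/-- The compatible system `exp_φ(log_φ(ξ) / θ ^ i)` of `θ`-division points of `ξ`. -/
def divisionPoint (r : ℕ) (k : ℕ → CInfty Fq) (ξ : CInfty Fq) (i : ℕ) : CInfty Fq :=
  evalAt (expSeries r k) (evalAt (logSeries r k) ξ / theta Fq ^ i)

theorem coeff_agf_fundPeriod (ξ : CInfty Fq) (i : ℕ) :
    PowerSeries.coeff i (agf r k (fundPeriod r k ξ)) = divisionPoint r k ξ i := by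
  rw [agf, PowerSeries.coeff_mk, divisionPoint, fundPeriod, pow_succ',
    mul_div_mul_left _ _ theta_ne_zero]

theorem norm_log_div_le (hr : 1 ≤ r) (hk : ∀ i, 1 ≤ i → i ≤ r → ‖k i‖ ≤ 1)
    {ξ : CInfty Fq} (hξ : ‖ξ‖ < logRadius Fq r) (i : ℕ) :
    ‖evalAt (logSeries r k) ξ / theta Fq ^ i‖ ≤ ‖ξ‖ / qF ^ i := by
  rw [norm_div, norm_pow, norm_theta]
  gcongr
  exact norm_evalAt_logSeries_le hr hk hξ

theorem norm_log_div_lt (hr : 1 ≤ r) (hk : ∀ i, 1 ≤ i → i ≤ r → ‖k i‖ ≤ 1)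
    {ξ : CInfty Fq} (hξ : ‖ξ‖ < logRadius Fq r) (i : ℕ) :
    ‖evalAt (logSeries r k) ξ / theta Fq ^ i‖ < logRadius Fq r :=
  ((norm_log_div_le hr hk hξ i).trans
    (div_le_self (norm_nonneg _) (one_le_pow₀ one_lt_card_real.le))).trans_lt hξ

theorem divisionPoint_zero (hr : 1 ≤ r) (hk : ∀ i, 1 ≤ i → i ≤ r → ‖k i‖ ≤ 1)
    {ξ : CInfty Fq} (hξ : ‖ξ‖ < logRadius Fq r) : divisionPoint r k ξ 0 = ξ := by
  rw [divisionPoint, pow_zero, div_one, evalAt_exp_log hr hk hξ]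

theorem norm_divisionPoint_le (hr : 1 ≤ r) (hk : ∀ i, 1 ≤ i → i ≤ r → ‖k i‖ ≤ 1)
    {ξ : CInfty Fq} (hξ : ‖ξ‖ < logRadius Fq r) (i : ℕ) :
    ‖divisionPoint r k ξ i‖ ≤ ‖ξ‖ / qF ^ i :=
  (norm_evalAt_expSeries_le hr hk (norm_log_div_lt hr hk hξ i)).trans
    (norm_log_div_le hr hk hξ i)

theorem evalAt_phiTheta_divisionPoint (hr : 1 ≤ r) (hk : ∀ i, 1 ≤ i → i ≤ r → ‖k i‖ ≤ 1)
    {ξ : CInfty Fq} (hξ : ‖ξ‖ < logRadius Fq r) (i : ℕ) :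
    evalAt (phiTheta r k) (divisionPoint r k ξ (i + 1)) = divisionPoint r k ξ i := by
  rw [divisionPoint, ← evalAt_exp_theta_mul hr hk (norm_log_div_lt hr hk hξ _), divisionPoint,
    pow_succ', ← mul_div_assoc, mul_div_mul_left _ _ theta_ne_zero]

theorem evalAt_logSeries_divisionPoint (hr : 1 ≤ r) (hk : ∀ i, 1 ≤ i → i ≤ r → ‖k i‖ ≤ 1)
    {ξ : CInfty Fq} (hξ : ‖ξ‖ < logRadius Fq r) (i : ℕ) :
    evalAt (logSeries r k) (divisionPoint r k ξ i) = evalAt (logSeries r k) ξ / theta Fq ^ i :=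
  evalAt_log_exp hr hk (norm_log_div_lt hr hk hξ i)

theorem coeff_twistPS (i : ℤ) (n : ℕ) (f : (CInfty Fq)⟦X⟧) :
    PowerSeries.coeff n (twistPS i f) = twist i (PowerSeries.coeff n f) :=
  PowerSeries.coeff_map _ _ _

theorem twistPS_twistPS (i j : ℤ) (f : (CInfty Fq)⟦X⟧) :
    twistPS i (twistPS j f) = twistPS (i + j) f := by
  ext n
  simp only [coeff_twistPS, twist_twist]

theorem twistPS_zero (f : (CInfty Fq)⟦X⟧) : twistPS 0 f = f := by
  ext n
  rw [coeff_twistPS, twist_zero]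

theorem twistPS_C (i : ℤ) (c : CInfty Fq) :
    twistPS i (PowerSeries.C c) = PowerSeries.C (twist i c) :=
  PowerSeries.map_C _ _

/-- The functional equation of the Anderson generating function of a period. -/
theorem agf_functional_equation (hr : 1 ≤ r) (hk : ∀ i, 1 ≤ i → i ≤ r → ‖k i‖ ≤ 1)
    {ξ : CInfty Fq} (hξ : ‖ξ‖ < logRadius Fq r) (hmem : ξ ∈ thetaTorsion r k) :
    (PowerSeries.X - PowerSeries.C (theta Fq)) * agf r k (fundPeriod r k ξ) =
      ∑ i ∈ Finset.Icc 1 r, PowerSeries.C (k i) * twistPS i (agf r k (fundPeriod r k ξ)) := by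
  ext n
  rw [sub_mul, map_sub, map_sum]
  simp only [PowerSeries.coeff_C_mul, coeff_twistPS, coeff_agf_fundPeriod, twist_natCast,
    frob_pow_apply]
  rw [sub_eq_iff_eq_add', ← evalAt_phiTheta]
  -- The constant term says φ_θ(ξ) = 0; each higher coefficient says that φ_θ maps one division
  -- point to the previous one.
  cases n with
  | zero =>
    rw [divisionPoint_zero hr hk hξ, evalAt_phiTheta_of_mem hmem, PowerSeries.coeff_zero_X_mul]
  | succ n =>
    rw [evalAt_phiTheta_divisionPoint hr hk hξ, PowerSeries.coeff_succ_X_mul, coeff_agf_fundPeriod]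

end Torsion

/-! ### Gauss norms on the disc of radius `q` -/

/-- The Gauss norm of `f` on the disc of radius `q` is at most `A`. -/
def GaussBound (A : ℝ) (f : (CInfty Fq)⟦X⟧) : Prop :=
  ∀ i, ‖PowerSeries.coeff i f‖ * (qF : ℝ) ^ i ≤ A

namespace GaussBound

variable {A B : ℝ} {f g : (CInfty Fq)⟦X⟧}

theorem nonneg (hf : GaussBound A f) : 0 ≤ A := le_trans (by positivity) (hf 0)

theorem mono (hf : GaussBound A f) (h : A ≤ B) : GaussBound B f := fun i => (hf i).trans h

theorem norm_coeff_le (hf : GaussBound A f) (i : ℕ) : ‖PowerSeries.coeff i f‖ ≤ A :=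
  (le_mul_of_one_le_right (norm_nonneg _) (one_le_pow₀ one_lt_card_real.le)).trans (hf i)

theorem sum {ι : Type*} {s : Finset ι} {f : ι → (CInfty Fq)⟦X⟧} (hA : 0 ≤ A)
    (hf : ∀ i ∈ s, GaussBound A (f i)) : GaussBound A (∑ i ∈ s, f i) := fun n => by
  rw [map_sum, ← le_div_iff₀ (by positivity)]
  refine IsUltrametricDist.norm_sum_le_of_forall_le_of_nonneg (by positivity) fun i hi => ?_
  rw [le_div_iff₀ (by positivity)]
  exact hf i hi n

theorem mul (hf : GaussBound A f) (hg : GaussBound B g) : GaussBound (A * B) (f * g) := fun n => by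
  have := hf.nonneg
  have := hg.nonneg
  rw [PowerSeries.coeff_mul, ← le_div_iff₀ (by positivity)]
  refine IsUltrametricDist.norm_sum_le_of_forall_le_of_nonneg (by positivity) fun p hp => ?_
  rw [le_div_iff₀ (by positivity), ← Finset.HasAntidiagonal.mem_antidiagonal.1 hp, norm_mul, pow_add,
    mul_mul_mul_comm]
  gcongr
  · exact hf _
  · exact hg _

theorem C (c : CInfty Fq) : GaussBound ‖c‖ (PowerSeries.C c) := fun n => by
  rw [PowerSeries.coeff_C]
  split_ifs with h
  · simp [h]
  · simp

theorem X_sub_theta : GaussBound (qF : ℝ) (PowerSeries.X - PowerSeries.C (theta Fq)) := fun n => by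
  rw [map_sub, PowerSeries.coeff_C, PowerSeries.coeff_X]
  rcases n with - | - | n
  · simp [norm_theta]
  · simp
  · simp

theorem neg (hf : GaussBound A f) : GaussBound A (-f) := fun n => by
  rw [map_neg, norm_neg]
  exact hf n

theorem prod {ι : Type*} (s : Finset ι) {f : ι → (CInfty Fq)⟦X⟧} {A : ι → ℝ}
    (hf : ∀ i ∈ s, GaussBound (A i) (f i)) : GaussBound (∏ i ∈ s, A i) (∏ i ∈ s, f i) := by
  classical
  induction s using Finset.induction_on with
  | empty => simpa using C (1 : CInfty Fq)
  | insert a s ha ih =>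
    rw [Finset.prod_insert ha, Finset.prod_insert ha]
    exact (hf a (by simp)).mul (ih fun i hi => hf i (by simp [hi]))

/-- The variable t is not twisted, so the weight qⁱ stays as it is, and it is at most its own q^m-th
power. -/
theorem twist (hf : GaussBound A f) (m : ℕ) : GaussBound (A ^ qF ^ m) (twistPS m f) := fun n => by
  rw [coeff_twistPS, twist_natCast, norm_frob_pow]
  refine le_trans ?_ (pow_le_pow_left₀ (by positivity) (hf n) _)
  rw [mul_pow]
  gcongr
  exact le_self_pow₀ (one_le_pow₀ one_lt_card_real.le) (card_pow_pos m).ne'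

theorem det {ι : Type*} [Fintype ι] [DecidableEq ι] {M : Matrix ι ι (CInfty Fq)⟦X⟧} {A : ι → ℝ}
    (hA : ∀ i, 0 ≤ A i) (hM : ∀ i j, GaussBound (A i) (M i j)) :
    GaussBound (∏ i, A i) M.det := by
  rw [Matrix.det_apply]
  refine sum (Finset.prod_nonneg fun i _ => hA i) fun σ _ => ?_
  have h : GaussBound (∏ i, A i) (∏ i, M (σ i) i) := by
    -- The bounds depend on the row only, so the product of bounds is reindexed by σ to match the
    -- factors M (σ i) i.
    rw [← Equiv.prod_comp σ]
    exact prod _ fun i _ => hM _ _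
  rcases Int.units_eq_one_or (Equiv.Perm.sign σ) with h1 | h1
  · simpa [h1] using h
  · simpa [h1] using h.neg

theorem isRestricted (hf : GaussBound A f) : PowerSeries.IsRestricted 1 f := by
  rw [PowerSeries.isRestricted_iff']
  have h := (tendsto_pow_atTop_nhds_zero_of_lt_one (inv_nonneg.2 (Nat.cast_nonneg qF))
    (inv_lt_one_of_one_lt₀ (one_lt_card_real (Fq := Fq)))).const_mul A
  rw [mul_zero] at h
  refine squeeze_zero (fun n => by positivity) (fun n => ?_) h
  rw [one_pow, mul_one, inv_pow, ← div_eq_mul_inv, le_div_iff₀ (by positivity)]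
  exact hf n

end GaussBound

/-- A restricted power series is a unit of `𝕋` if its constant term strictly dominates. -/
theorem Tate.isUnit_of_dominant (d : Tate Fq) (h0 : PowerSeries.coeff 0 d.1 ≠ 0) {δ : ℝ}
    (hδ : 0 ≤ δ) (hδ1 : δ < 1)
    (h : ∀ i, ‖PowerSeries.coeff (i + 1) d.1‖ ≤ δ * ‖PowerSeries.coeff 0 d.1‖) : IsUnit d := by
  set D := ‖PowerSeries.coeff 0 d.1‖ with hD
  have hDpos : 0 < D := norm_pos_iff.2 h0
  obtain ⟨e, he⟩ : ∃ e : (CInfty Fq)⟦X⟧, d.1 * e = 1 := ⟨d.1⁻¹, PowerSeries.mul_inv_cancel _ (by simpa using h0)⟩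
  -- Solving d e = 1 for the coefficient of t^(n+1) in e: after division by the constant term of d,
  -- only earlier coefficients of e occur.
  have hrec (n : ℕ) {B : ℝ} (hB : 0 ≤ B) (hb : ∀ i, i ≤ n →
      ‖PowerSeries.coeff (i + 1) d.1‖ * ‖PowerSeries.coeff (n - i) e‖ ≤ D * B) :
      ‖PowerSeries.coeff (n + 1) e‖ ≤ B := by
    have h1 := congrArg (PowerSeries.coeff (n + 1)) he
    rw [PowerSeries.coeff_mul, Finset.Nat.sum_antidiagonal_eq_sum_range_succ_mk,
      Finset.sum_range_succ', PowerSeries.coeff_one, if_neg (by omega)] at h1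
    simp only [Nat.sub_zero] at h1
    refine le_of_mul_le_mul_left ?_ hDpos
    rw [hD, ← norm_mul, eq_neg_of_add_eq_zero_right h1, norm_neg]
    refine IsUltrametricDist.norm_sum_le_of_forall_le_of_nonneg (by positivity) fun i hi => ?_
    have hi := Finset.mem_range.1 hi
    rw [norm_mul, Nat.add_sub_add_right]
    exact hb i (by omega)
  set E := ‖PowerSeries.coeff 0 e‖ with hE
  have hbd (n : ℕ) : ‖PowerSeries.coeff n e‖ ≤ E := by
    induction n using Nat.strong_induction_on with
    | _ n ih =>
    rcases n with - | n
    · exact le_rfl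
    refine hrec n (norm_nonneg _) fun i hi => ?_
    refine mul_le_mul ((h i).trans (mul_le_of_le_one_left hDpos.le hδ1.le)) (ih _ (by omega))
      (norm_nonneg _) hDpos.le
  have hd : Tendsto (fun n => ‖PowerSeries.coeff n d.1‖ * E) atTop (𝓝 0) := by
    simpa using ((PowerSeries.isRestricted_iff' 1 d.1).1 d.2).mul_const E
  -- Each pass through the recursion improves the eventual bound on e by a factor δ, down to the
  -- level ε. Terms with a high coefficient of d are small because d is restricted; in the others
  -- the index of e is still beyond N, so the previous bound applies and δ is gained.
  have hsmall {ε : ℝ} (hε : 0 < ε) (m : ℕ) :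
      ∃ N, ∀ n ≥ N, ‖PowerSeries.coeff n e‖ ≤ max (δ ^ m * E) ε := by
    obtain ⟨M, hM⟩ := eventually_atTop.1 (hd.eventually (gt_mem_nhds (mul_pos hDpos hε)))
    induction m with
    | zero => exact ⟨0, fun n _ => (hbd n).trans (by simp)⟩
    | succ m ih =>
      obtain ⟨N, hN⟩ := ih
      refine ⟨N + M + 1, fun n hn => ?_⟩
      obtain ⟨n, rfl⟩ := Nat.exists_eq_add_of_le' (show 1 ≤ n by omega)
      refine hrec n (by positivity) fun i hi => ?_
      rcases le_or_gt M (i + 1) with hMi | hMi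
      · calc _ ≤ ‖PowerSeries.coeff (i + 1) d.1‖ * E := by
              gcongr
              exact hbd _
          _ ≤ D * ε := (hM _ hMi).le
          _ ≤ _ := by
              gcongr
              exact le_max_right _ _
      · calc _ ≤ δ * D * max (δ ^ m * E) ε := mul_le_mul (h i) (hN _ (by omega))
              (norm_nonneg _) (by positivity)
          _ = D * max (δ ^ (m + 1) * E) (δ * ε) := by
              rw [mul_right_comm, mul_comm, mul_max_of_nonneg _ _ hδ]
              ring_nf
          _ ≤ _ := by
              gcongr
              exact mul_le_of_le_one_left hε.le hδ1.le
  have hres : PowerSeries.IsRestricted 1 e := by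
    rw [PowerSeries.isRestricted_iff', Metric.tendsto_atTop]
    intro ε hε
    have hpow : Tendsto (fun m => δ ^ m * E) atTop (𝓝 0) := by
      simpa using (tendsto_pow_atTop_nhds_zero_of_lt_one hδ hδ1).mul_const E
    obtain ⟨m, hm⟩ := (hpow.eventually (gt_mem_nhds (half_pos hε))).exists
    obtain ⟨N, hN⟩ := hsmall (half_pos hε) m
    refine ⟨N, fun n hn => ?_⟩
    have := (hN n hn).trans (max_le hm.le le_rfl)
    simp only [one_pow, mul_one, dist_zero_right, norm_norm]
    linarith
  exact IsUnit.of_mul_eq_one ⟨e, hres⟩ (Subtype.ext he)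

/-! ### The Moore determinant of the torsion points and invertibility of `Υ` -/

section Moore

variable {r : ℕ} {k : ℕ → CInfty Fq}

/-- The Moore matrix with entries `ξ_j ^ (q ^ i)`. -/
def mooreMatrix (ξ : Fin r → CInfty Fq) : Matrix (Fin r) (Fin r) (CInfty Fq) :=
  Matrix.of fun i j => (frob Fq ^ i.1) (ξ j)

/-- A left kernel vector v gives the F_q-linear polynomial ∑ v_i X^(q^i), of degree at most q^(r-1),
which vanishes at all q^r distinct F_q-combinations of the ξ_j. -/
theorem det_mooreMatrix_ne_zero {ξ : Fin r → CInfty Fq} (hξ : LinearIndependent Fq ξ) :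
    (mooreMatrix ξ).det ≠ 0 := by
  intro hdet
  obtain ⟨v, hv0, hv⟩ := Matrix.exists_vecMul_eq_zero_iff.2 hdet
  let P : (CInfty Fq)[X] := ∑ i : Fin r, Polynomial.C (v i) * Polynomial.X ^ qF ^ i.1
  have hinj : Function.Injective fun c : Fin r → Fq => ∑ j, c j • ξ j :=
    linearIndependent_iff_injective_fintypeLinearCombination.1 hξ
  have heval (c : Fin r → Fq) : P.eval (∑ j, c j • ξ j) = 0 := by
    have h1 (i : Fin r) : v i * (∑ j, c j • ξ j) ^ qF ^ i.1 =
        ∑ j, algebraMap Fq (CInfty Fq) (c j) * (v i * mooreMatrix ξ i j) := by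
      rw [← frob_pow_apply, map_sum, Finset.mul_sum]
      refine Finset.sum_congr rfl fun j _ => ?_
      rw [Algebra.smul_def, map_mul, TauSeries.frob_pow_algebraMap, mooreMatrix, Matrix.of_apply]
      ring
    simp only [P, Polynomial.eval_finsetSum, Polynomial.eval_mul, Polynomial.eval_C,
      Polynomial.eval_pow, Polynomial.eval_X, h1]
    rw [Finset.sum_comm]
    refine Finset.sum_eq_zero fun j _ => ?_
    rw [← Finset.mul_sum]
    have h2 : ∑ i, v i * mooreMatrix ξ i j = 0 := congrFun hv j
    rw [h2, mul_zero]
  have hdeg : P.natDegree < Fintype.card (Fin r → Fq) := by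
    rw [Fintype.card_fun, Fintype.card_fin]
    obtain ⟨i0, -⟩ := Function.ne_iff.1 hv0
    have hr : 0 < r := i0.pos
    refine (Polynomial.natDegree_sum_le_of_forall_le (n := qF ^ (r - 1)) _ _ fun i _ => ?_).trans_lt
      (Nat.pow_lt_pow_right Fintype.one_lt_card (by omega))
    exact (Polynomial.natDegree_C_mul_X_pow_le _ _).trans
      (Nat.pow_le_pow_right Fintype.card_pos (by omega))
  have hP := Polynomial.eq_zero_of_natDegree_lt_card_of_eval_eq_zero P hinj heval hdeg
  refine hv0 (funext fun i => ?_)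
  have hc := congrArg (Polynomial.coeff · (qF ^ i.1)) hP
  simp only [P, Polynomial.finsetSum_coeff, Polynomial.coeff_C_mul_X_pow,
    Polynomial.coeff_zero] at hc
  rw [Finset.sum_eq_single i] at hc
  · simpa using hc
  · intro j _ hj
    refine if_neg fun h => hj (Fin.ext ?_)
    exact (Nat.pow_right_injective Fintype.one_lt_card h).symm
  · simp

/-- The companion matrix expressing the Frobenius twist of the Moore matrix. -/
def torsionCompanion (r : ℕ) (k : ℕ → CInfty Fq) : Matrix (Fin r) (Fin r) (CInfty Fq) :=
  Matrix.of fun i j => if i.1 + 1 < r then (if j.1 = i.1 + 1 then 1 else 0)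
    else -(k r)⁻¹ * (phiTheta r k).coeff j.1

/-- The first column has a single nonzero entry, -θ/k_r in the last row, and its minor is the
identity matrix. -/
theorem norm_det_torsionCompanion (hr : 1 ≤ r) (hkr : ‖k r‖ = 1) :
    ‖(torsionCompanion r k).det‖ = qF := by
  obtain ⟨n, rfl⟩ := Nat.exists_eq_add_of_le' hr
  rw [Matrix.det_succ_column_zero, Finset.sum_eq_single (Fin.last n)]
  · have h1 : (torsionCompanion (n + 1) k).submatrix (Fin.last n).succAbove Fin.succ = 1 := by
      ext i j
      have := i.2
      simp only [torsionCompanion, Matrix.submatrix_apply, Matrix.of_apply, Fin.succAbove_last,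
        Fin.val_castSucc, Fin.val_succ, Matrix.one_apply, Fin.ext_iff]
      rw [if_pos (by omega)]
      exact if_congr (by omega) rfl rfl
    have h0 : torsionCompanion (n + 1) k (Fin.last n) 0 = -(k (n + 1))⁻¹ * theta Fq := by
      simp only [torsionCompanion, Matrix.of_apply, Fin.val_last, lt_irrefl, if_false]
      rfl
    rw [h1, h0]
    simp [hkr, norm_theta]
  · intro i _ hi
    have : i.1 ≠ n := fun h => hi (Fin.ext h)
    have h0 : torsionCompanion (n + 1) k i 0 = 0 := by
      simp only [torsionCompanion, Matrix.of_apply]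
      rw [if_pos (by omega), if_neg (by simp)]
    simp [h0]
  · simp

/-- Frobenius shifts the rows; the new last row ξ_j^(q^r) is eliminated by φ_θ(ξ_j) = 0. -/
theorem mooreMatrix_map_frob (hr : 1 ≤ r) (hkr : k r ≠ 0) {ξ : Fin r → CInfty Fq}
    (hξ : ∀ j, ξ j ∈ thetaTorsion r k) :
    (mooreMatrix ξ).map (frob Fq) = torsionCompanion r k * mooreMatrix ξ := by
  ext i j
  have hfrob : (mooreMatrix ξ).map (frob Fq) i j = (frob Fq ^ (i.1 + 1)) (ξ j) := by
    rw [pow_succ', RingAut.mul_apply]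
    rfl
  rw [hfrob, Matrix.mul_apply]
  simp only [torsionCompanion, mooreMatrix, Matrix.of_apply]
  rcases lt_or_ge (i.1 + 1) r with hi | hi
  · simp only [if_pos hi]
    rw [Finset.sum_eq_single ⟨i.1 + 1, hi⟩]
    · simp
    · intro l _ hl
      rw [if_neg fun h => hl (Fin.ext h), zero_mul]
    · simp
  · have hir : i.1 + 1 = r := by omega
    simp only [hir, lt_irrefl, if_false, mul_assoc, ← Finset.mul_sum]
    have h := evalAt_phiTheta_of_mem (hξ j)
    rw [evalAt, tsum_eq_sum (s := Finset.range (r + 1)) fun n hn => by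
      rw [coeff_phiTheta_of_lt (by simpa using hn), zero_mul], Finset.sum_range_succ,
      coeff_phiTheta_of_pos hr le_rfl, Finset.sum_range] at h
    simp only [← frob_pow_apply] at h
    rw [eq_neg_of_add_eq_zero_left h]
    field_simp

/-- Taking determinants in the companion relation gives |D|^q = q |D| for the Moore determinant D,
hence |D|^(q-1) = q. The product on the right has the same (q-1)-st power, because (q-1) ∑_{i<r} q^i
= q^r - 1 and s^(q^r - 1) = q. -/
theorem norm_det_mooreMatrix (hr : 1 ≤ r) (hkr : ‖k r‖ = 1) {ξ : Fin r → CInfty Fq}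
    (hξ : ∀ j, ξ j ∈ thetaTorsion r k) (hli : LinearIndependent Fq ξ) :
    ‖(mooreMatrix ξ).det‖ = ∏ i : Fin r, torsionRadius Fq r ^ qF ^ i.1 := by
  have hkr0 : k r ≠ 0 := by
    rw [← norm_pos_iff, hkr]
    exact one_pos
  have hD := norm_pos_iff.2 (det_mooreMatrix_ne_zero hli)
  have hs := one_lt_torsionRadius (Fq := Fq) hr
  have hq : 1 < qF := Fintype.one_lt_card
  have h := congrArg (fun M => ‖Matrix.det M‖) (mooreMatrix_map_frob hr hkr0 hξ)
  have hmap : ((mooreMatrix ξ).map (frob Fq)).det = frob Fq (mooreMatrix ξ).det :=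
    (RingEquiv.map_det (frob Fq) _).symm
  simp only [hmap, Matrix.det_mul, norm_mul, norm_det_torsionCompanion hr hkr, frob_apply,
    norm_pow] at h
  refine (pow_left_inj₀ hD.le (by positivity) (show qF - 1 ≠ 0 by omega)).1 ?_
  · rw [Finset.prod_pow_eq_pow_sum, ← pow_mul, Fin.sum_univ_eq_sum_range (fun i => qF ^ i) r,
      Nat.geomSum_eq hq, Nat.div_mul_cancel (by simpa using Nat.sub_dvd_pow_sub_pow qF 1 r),
      torsionRadius_pow_sub hr]
    refine mul_right_cancel₀ hD.ne' ?_
    rw [← pow_succ, Nat.sub_add_cancel hq.le, h]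

end Moore

section UpsilonUnit

variable {r : ℕ} {k : ℕ → CInfty Fq} {ξ lam : Fin r → CInfty Fq}

theorem gaussBound_agf (hr : 1 ≤ r) (hk : ∀ i, 1 ≤ i → i ≤ r → ‖k i‖ ≤ 1) (hkr : ‖k r‖ = 1)
    {ξ : CInfty Fq} (hξ : ξ ∈ thetaTorsion r k) :
    GaussBound (torsionRadius Fq r) (agf r k (fundPeriod r k ξ)) := fun n => by
  have h := norm_le_torsionRadius hr hk hkr hξ
  rw [coeff_agf_fundPeriod, ← le_div_iff₀ (by positivity)]
  refine (norm_divisionPoint_le hr hk (h.trans_lt (torsionRadius_lt_logRadius hr)) n).trans ?_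
  gcongr

theorem gaussBound_Upsilon (hr : 1 ≤ r) (hk : ∀ i, 1 ≤ i → i ≤ r → ‖k i‖ ≤ 1) (hkr : ‖k r‖ = 1)
    (hξ : ∀ j, ξ j ∈ thetaTorsion r k) (hlam : ∀ j, lam j = fundPeriod r k (ξ j)) (i j : Fin r) :
    GaussBound (torsionRadius Fq r ^ qF ^ i.1) (Upsilon r k lam i j) := by
  rw [Upsilon, Matrix.of_apply, hlam]
  exact (gaussBound_agf hr hk hkr (hξ j)).twist i.1

theorem constantCoeff_det_Upsilon (hr : 1 ≤ r) (hk : ∀ i, 1 ≤ i → i ≤ r → ‖k i‖ ≤ 1)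
    (hkr : ‖k r‖ = 1) (hξ : ∀ j, ξ j ∈ thetaTorsion r k)
    (hlam : ∀ j, lam j = fundPeriod r k (ξ j)) :
    PowerSeries.coeff 0 (Upsilon r k lam).det = (mooreMatrix ξ).det := by
  rw [PowerSeries.coeff_zero_eq_constantCoeff_apply, RingHom.map_det]
  congr 1
  ext i j
  have h := (norm_le_torsionRadius hr hk hkr (hξ j)).trans_lt (torsionRadius_lt_logRadius hr)
  rw [RingHom.mapMatrix_apply, Matrix.map_apply,
    ← PowerSeries.coeff_zero_eq_constantCoeff_apply, Upsilon, Matrix.of_apply, coeff_twistPS, hlam,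
    coeff_agf_fundPeriod, divisionPoint_zero hr hk h, twist_natCast]
  rfl

/-- The row bounds s^(q^i) multiply to exactly the norm of the constant term of det Υ. As they hold
on radius q, each higher coefficient is smaller than that term by a factor at least q. -/
theorem exists_GL_eq_Upsilon (hr : 1 ≤ r) (hk : ∀ i, 1 ≤ i → i ≤ r → ‖k i‖ ≤ 1)
    (hkr : ‖k r‖ = 1) (hξ : ∀ j, ξ j ∈ thetaTorsion r k) (hli : LinearIndependent Fq ξ)
    (hlam : ∀ j, lam j = fundPeriod r k (ξ j)) :
    ∃ U : GL (Fin r) (Tate Fq), ∀ i j,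
      ((U i j : Tate Fq) : (CInfty Fq)⟦X⟧) = Upsilon r k lam i j := by
  have hs := one_lt_torsionRadius (Fq := Fq) hr
  have hb := gaussBound_Upsilon hr hk hkr hξ hlam
  let U : Matrix (Fin r) (Fin r) (Tate Fq) :=
    Matrix.of fun i j => ⟨Upsilon r k lam i j, (hb i j).isRestricted⟩
  have hdet : U.det.1 = (Upsilon r k lam).det :=
    RingHom.map_det (PowerSeries.IsRestricted.subring (R := CInfty Fq) 1).subtype U
  have hd : GaussBound ‖(mooreMatrix ξ).det‖ U.det.1 := by
    rw [hdet, norm_det_mooreMatrix hr hkr hξ hli]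
    exact GaussBound.det (fun i => by positivity) hb
  have hq := one_lt_card_real (Fq := Fq)
  have hunit : IsUnit U.det := by
    refine Tate.isUnit_of_dominant _ ?_ (δ := (qF : ℝ)⁻¹) (by positivity)
      (inv_lt_one_of_one_lt₀ hq) fun i => ?_
    · rw [hdet, constantCoeff_det_Upsilon hr hk hkr hξ hlam]
      exact det_mooreMatrix_ne_zero hli
    · rw [hdet, constantCoeff_det_Upsilon hr hk hkr hξ hlam, ← hdet, mul_comm, ← div_eq_mul_inv,
        le_div_iff₀ (by positivity)]
      refine le_trans ?_ (hd (i + 1))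
      gcongr
      exact le_self_pow₀ hq.le (by omega)
  exact ⟨Matrix.GeneralLinearGroup.mk'' U hunit, fun i j => rfl⟩

/-- Invertibility over all of C_∞[[t]], where `Psi` is formed; a nonzero constant term suffices. -/
theorem isUnit_det_Upsilon (hr : 1 ≤ r) (hk : ∀ i, 1 ≤ i → i ≤ r → ‖k i‖ ≤ 1)
    (hkr : ‖k r‖ = 1) (hξ : ∀ j, ξ j ∈ thetaTorsion r k) (hli : LinearIndependent Fq ξ)
    (hlam : ∀ j, lam j = fundPeriod r k (ξ j)) : IsUnit (Upsilon r k lam).det := by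
  rw [PowerSeries.isUnit_iff_constantCoeff, ← PowerSeries.coeff_zero_eq_constantCoeff_apply,
    constantCoeff_det_Upsilon hr hk hkr hξ hlam]
  exact (det_mooreMatrix_ne_zero hli).isUnit

end UpsilonUnit

/-! ### The rows `[f_{1,n}, …, f_{r,n}]` -/

theorem twist_comp (i j : ℤ) :
    (twist i).comp (twist j) = (twist (i + j) : CInfty Fq →+* CInfty Fq) :=
  RingHom.ext fun x => twist_twist i j x

theorem norm_twist_le_one (i : ℤ) {x : CInfty Fq} (hx : ‖x‖ ≤ 1) : ‖twist i x‖ ≤ 1 := by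
  rcases Int.eq_nat_or_neg i with ⟨n, rfl | rfl⟩
  · rw [twist_natCast, norm_frob_pow]
    exact pow_le_one₀ (norm_nonneg _) hx
  · refine (pow_le_one_iff_of_nonneg (norm_nonneg _) (card_pow_pos (Fq := Fq) n).ne').1 ?_
    rwa [← norm_frob_pow, ← twist_natCast, twist_twist, add_neg_cancel, twist_zero]

section Rows

variable {r : ℕ} {k : ℕ → CInfty Fq}

/-- The definition splits off the most twisted factor on the left. Splitting off the untwisted Φᵗʳ
on the right instead makes row n+1 equal to the twist of row n times Φᵗʳ, the recursion used for the
bounds, for injectivity and for the pairing with `adjointSeries`. -/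
theorem PhiProd_succ' (n : ℕ) : PhiProd r k (n + 1) =
    (PhiProd r k n).map (Polynomial.mapRingHom (twist 1)) * (PhiMat r k)ᵀ := by
  induction n with
  | zero =>
    have h : (PhiMat r k)ᵀ.map (Polynomial.map (twist ((0 : ℕ) : ℤ))) = (PhiMat r k)ᵀ := by
      have h0 : (twist ((0 : ℕ) : ℤ) : CInfty Fq →+* CInfty Fq) = RingHom.id _ :=
        RingHom.ext twist_zero
      ext1 i j
      rw [Matrix.map_apply, h0, Polynomial.map_id]
    have h1 : (PhiProd r k 0).map (Polynomial.mapRingHom (twist 1)) = 1 :=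
      Matrix.map_one _ (map_zero _) (map_one _)
    rw [h1, one_mul]
    exact (mul_one _).trans h
  | succ n ih =>
    have e (m : ℕ) : PhiProd r k (m + 1) =
      (PhiMat r k)ᵀ.map (Polynomial.map (twist m)) * PhiProd r k m := rfl
    rw [e (n + 1)]
    nth_rw 1 [ih]
    rw [← Matrix.mul_assoc, e n, Matrix.map_mul]
    congr 2
    ext1 i j
    simp only [Matrix.map_apply, Polynomial.coe_mapRingHom, Polynomial.map_map, twist_comp]
    congr 2
    push_cast
    ring

/-- The polynomial `f_{j,n}` as a power series in `t`. -/
def rowSeries (r : ℕ) (k : ℕ → CInfty Fq) (n : ℕ) (j : Fin r) : (CInfty Fq)⟦X⟧ := fRow r k n j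

theorem fRow_eq (n : ℕ) {i : Fin r} (hi : i.1 + 1 = r) (j : Fin r) :
    fRow r k n j = PhiProd r k n i j := by
  rw [fRow, Finset.sum_eq_single i]
  · exact if_pos hi
  · intro l _ hl
    exact if_neg fun h => hl (Fin.ext (by omega))
  · simp

theorem rowSeries_zero (j : Fin r) : rowSeries r k 0 j = if j.1 + 1 = r then 1 else 0 := by
  have hj := j.2
  rw [rowSeries, fRow_eq 0 (i := ⟨r - 1, by omega⟩) (show r - 1 + 1 = r by omega), PhiProd,
    Matrix.one_apply]
  simp only [Fin.ext_iff]
  split_ifs with h1 h2 h2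
  · exact Polynomial.coe_one
  · omega
  · omega
  · exact Polynomial.coe_zero

theorem rowSeries_succ (n : ℕ) (j : Fin r) : rowSeries r k (n + 1) j =
    ∑ i, twistPS 1 (rowSeries r k n i) * (PhiMat r k j i : (CInfty Fq)⟦X⟧) := by
  have hj := j.2
  have hi : (⟨r - 1, by omega⟩ : Fin r).1 + 1 = r := by simp only; omega
  simp only [rowSeries, fRow_eq _ hi]
  rw [PhiProd_succ', Matrix.mul_apply]
  have hsum (p : Fin r → (CInfty Fq)[X]) :
      ((∑ i, p i : (CInfty Fq)[X]) : (CInfty Fq)⟦X⟧) = ∑ i, (p i : (CInfty Fq)⟦X⟧) :=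
    map_sum (Polynomial.coeToPowerSeries.ringHom (R := CInfty Fq)) p Finset.univ
  rw [hsum]
  refine Finset.sum_congr rfl fun i _ => ?_
  exact (Polynomial.coe_mul _ _).trans (congrArg (· * _) Polynomial.polynomial_map_coe)

theorem PhiMat_coe_of_lt {j : Fin r} (hj : j.1 + 1 < r) (i : Fin r) :
    (PhiMat r k j i : (CInfty Fq)⟦X⟧) = if i = ⟨j.1 + 1, hj⟩ then 1 else 0 := by
  simp only [PhiMat, Matrix.of_apply, if_pos hj, Fin.ext_iff]
  split_ifs
  · exact Polynomial.coe_one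
  · exact Polynomial.coe_zero

theorem PhiMat_coe_last_zero {i j : Fin r} (hj : j.1 + 1 = r) (hi : i.1 = 0) :
    (PhiMat r k j i : (CInfty Fq)⟦X⟧) = PowerSeries.C (twist (-(r : ℤ)) (k r))⁻¹ *
      (PowerSeries.X - PowerSeries.C (theta Fq)) := by
  simp [PhiMat, hj, hi]

theorem PhiMat_coe_last {i j : Fin r} (hj : j.1 + 1 = r) (hi : i.1 ≠ 0) :
    (PhiMat r k j i : (CInfty Fq)⟦X⟧) =
      PowerSeries.C (-(twist (-(i.1 : ℤ)) (k i.1)) / twist (-(r : ℤ)) (k r)) := by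
  simp only [PhiMat, Matrix.of_apply, hj, lt_irrefl, if_false, hi]
  exact Polynomial.coe_C _

theorem rowSeries_succ_of_lt (n : ℕ) {j : Fin r} (hj : j.1 + 1 < r) :
    rowSeries r k (n + 1) j = twistPS 1 (rowSeries r k n ⟨j.1 + 1, hj⟩) := by
  simp [rowSeries_succ, PhiMat_coe_of_lt hj]

/-- The denominator records the position in the row: moving from entry j+1 to entry j is a twist,
which raises it to the power q. In the last entry the factor t - θ has norm q, and q/s^(q^r) = 1/s
closes the cycle exactly; the other contributions have larger denominators. -/
theorem gaussBound_rowSeries (hr : 1 ≤ r) (hk : ∀ i, 1 ≤ i → i ≤ r → ‖k i‖ ≤ 1)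
    (hkr : ‖k r‖ = 1) (hkt : ∀ i, twist i (k r) = k r) (n : ℕ) (j : Fin r) :
    GaussBound (torsionRadius Fq r ^ qF ^ n / torsionRadius Fq r ^ qF ^ (r - 1 - j.1))
      (rowSeries r k n j) := by
  have hs := one_lt_torsionRadius (Fq := Fq) hr
  have hs0 : 0 < torsionRadius Fq r := by linarith
  induction n generalizing j with
  | zero =>
    rw [rowSeries_zero]
    split_ifs with hj
    · rw [show r - 1 - j.1 = 0 by omega, div_self (by positivity)]
      simpa using GaussBound.C (1 : CInfty Fq)
    · exact fun i => by
        rw [map_zero, norm_zero, zero_mul]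
        positivity
  | succ n ih =>
    have ih' (i : Fin r) : GaussBound (torsionRadius Fq r ^ qF ^ (n + 1) /
        torsionRadius Fq r ^ qF ^ (r - i.1)) (twistPS 1 (rowSeries r k n i)) := by
      have h := (ih i).twist 1
      rwa [div_pow, ← pow_mul, ← pow_mul, ← pow_add, ← pow_add,
        show r - 1 - i.1 + 1 = r - i.1 by omega] at h
    rcases lt_or_ge (j.1 + 1) r with hj | hj
    · rw [rowSeries_succ_of_lt n hj]
      have h := ih' ⟨j.1 + 1, hj⟩
      rwa [show r - (j.1 + 1) = r - 1 - j.1 by omega] at h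
    have hj' : j.1 + 1 = r := by omega
    rw [rowSeries_succ, show r - 1 - j.1 = 0 by omega]
    refine GaussBound.sum (by positivity) fun i _ => ?_
    rcases eq_or_ne i.1 0 with hi | hi
    · rw [PhiMat_coe_last_zero hj' hi, hkt]
      refine ((ih' i).mul ((GaussBound.C _).mul GaussBound.X_sub_theta)).mono (le_of_eq ?_)
      rw [norm_inv, hkr, hi, Nat.sub_zero, torsionRadius_pow hr, logRadius, pow_zero, pow_one]
      have := one_lt_card_real (Fq := Fq)
      field_simp
    · rw [PhiMat_coe_last hj' hi, hkt]
      refine ((ih' i).mul (GaussBound.C _)).mono ?_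
      rw [norm_div, norm_neg, hkr, div_one]
      refine (mul_le_of_le_one_right (by positivity)
        (norm_twist_le_one _ (hk _ (by omega) i.2.le))).trans ?_
      refine div_le_div_of_nonneg_left (by positivity) (by positivity) ?_
      exact pow_le_pow_right₀ hs.le (Nat.pow_le_pow_right Fintype.card_pos (by omega))

end Rows

/-! ### Convergence of series of polynomials -/

section Series

variable {g : ℕ → (CInfty Fq)⟦X⟧} {c : ℕ → ℝ}

theorem GaussBound.summable_coeff (hg : ∀ n, GaussBound (c n) (g n)) (hc : Tendsto c atTop (𝓝 0))
    (l : ℕ) : Summable fun n => PowerSeries.coeff l (g n) := by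
  refine NonarchimedeanAddGroup.summable_of_tendsto_cofinite_zero ?_
  rw [Nat.cofinite_eq_atTop]
  exact squeeze_zero_norm (fun n => (hg n).norm_coeff_le l) hc

/-- The coefficientwise sum of a sequence of power series. -/
def coeffSum (g : ℕ → (CInfty Fq)⟦X⟧) : (CInfty Fq)⟦X⟧ :=
  PowerSeries.mk fun l => ∑' n, PowerSeries.coeff l (g n)

theorem GaussBound.coeffSum_sub (hg : ∀ n, GaussBound (c n) (g n)) (hc : Tendsto c atTop (𝓝 0))
    {ε : ℝ} (hε : 0 ≤ ε) {N : ℕ} (hN : ∀ n ≥ N, c n ≤ ε) :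
    GaussBound ε (coeffSum g - ∑ n ∈ Finset.range N, g n) := fun l => by
  rw [map_sub, map_sum, coeffSum, PowerSeries.coeff_mk,
    ← (summable_coeff hg hc l).sum_add_tsum_nat_add N, add_sub_cancel_left,
    ← le_div_iff₀ (by positivity)]
  refine IsUltrametricDist.norm_tsum_le_of_forall_le_of_nonneg (by positivity) fun n => ?_
  rw [le_div_iff₀ (by positivity)]
  exact (hg _ l).trans (hN _ (by omega))

theorem GaussBound.coeffSum (hg : ∀ n, GaussBound (c n) (g n)) (hc : Tendsto c atTop (𝓝 0))
    {ε : ℝ} (hε : 0 ≤ ε) (h : ∀ n, c n ≤ ε) : GaussBound ε (coeffSum g) := by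
  simpa using coeffSum_sub hg hc hε (N := 0) fun n _ => h n

/-- The sum of a convergent series of polynomials converges on the disc of radius `q`. -/
theorem GaussBound.tendsto_coeffSum (hg : ∀ n, GaussBound (c n) (g n))
    (hc : Tendsto c atTop (𝓝 0)) (hpoly : ∀ n, ∀ᶠ l in atTop, PowerSeries.coeff l (g n) = 0) :
    Tendsto (fun l => ‖PowerSeries.coeff l (DrinfeldLog.coeffSum g)‖ * (qF : ℝ) ^ l)
      atTop (𝓝 0) := by
  rw [Metric.tendsto_nhds]
  intro ε hε
  obtain ⟨N, hN⟩ := eventually_atTop.1 (hc.eventually (gt_mem_nhds (half_pos hε)))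
  have h : ∀ᶠ l in atTop, ∀ n ∈ Finset.range N, PowerSeries.coeff l (g n) = 0 :=
    (Filter.eventually_all_finset _).2 fun n _ => hpoly n
  filter_upwards [h] with l hl
  have h1 := coeffSum_sub hg hc (half_pos hε).le (fun n hn => (hN n hn).le) l
  rw [map_sub, map_sum, Finset.sum_eq_zero hl, sub_zero] at h1
  rw [dist_zero_right, Real.norm_of_nonneg (by positivity)]
  linarith

end Series

/-! ### The map `φ` -/

section PhiMap

variable {r : ℕ} {k : ℕ → CInfty Fq}

/-- The term `k_r⁻¹ aₙ f_{j,n}` of `φ(∑ aₙ τⁿ)`. -/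
def phiTerm (r : ℕ) (k : ℕ → CInfty Fq) (a : MM Fq r) (j : Fin r) (n : ℕ) : (CInfty Fq)⟦X⟧ :=
  PowerSeries.C ((k r)⁻¹ * a.1.coeff n) * rowSeries r k n j

theorem coe_ofPolynomial_eq_phiTerm (a : MM Fq r) (j : Fin r) (n : ℕ) :
    (Tate.ofPolynomial (Polynomial.C ((k r)⁻¹ * a.1.coeff n) * fRow r k n j)).1 =
      phiTerm r k a j n :=
  (Polynomial.coe_mul _ _).trans (congrArg (· * _) (Polynomial.coe_C _))

/-- The row bound s^(qⁿ) is below 𝔳^(qⁿ), so the quantities tending to 0 in the definition of 𝕄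
majorize the terms, even on radius q. -/
theorem gaussBound_phiTerm (hr : 1 ≤ r) (hk : ∀ i, 1 ≤ i → i ≤ r → ‖k i‖ ≤ 1)
    (hkr : ‖k r‖ = 1) (hkt : ∀ i, twist i (k r) = k r) (a : MM Fq r) (j : Fin r) (n : ℕ) :
    GaussBound (‖a.1.coeff n‖ * frakV Fq r ^ qF ^ n) (phiTerm r k a j n) := by
  have hs := one_lt_torsionRadius (Fq := Fq) hr
  refine ((GaussBound.C _).mul (gaussBound_rowSeries hr hk hkr hkt n j)).mono ?_
  rw [norm_mul, norm_inv, hkr, inv_one, one_mul, frakV_eq]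
  gcongr ?_ * ?_
  refine (div_le_self (by positivity) (one_le_pow₀ hs.le)).trans ?_
  gcongr ?_ ^ _
  exact le_self_pow₀ hs.le (card_pow_pos _).ne'

theorem eventually_coeff_phiTerm (a : MM Fq r) (j : Fin r) (n : ℕ) :
    ∀ᶠ l in atTop, PowerSeries.coeff l (phiTerm r k a j n) = 0 := by
  filter_upwards [eventually_gt_atTop (fRow r k n j).natDegree] with l hl
  rw [phiTerm, PowerSeries.coeff_C_mul, rowSeries, Polynomial.coeff_coe,
    Polynomial.coeff_eq_zero_of_natDegree_lt hl, mul_zero]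

theorem coe_phiTilde_trunc (a : MM Fq r) (N : ℕ) (j : Fin r) :
    (phiTilde r k (MM.trunc N a) j).1 = ∑ n ∈ Finset.range N, phiTerm r k a j n := by
  have h (n : ℕ) : (MM.trunc N a).1.coeff n = if n < N then a.1.coeff n else 0 := rfl
  rw [phiTilde, finsum_eq_sum_of_support_subset (s := Finset.range N)]
  · rw [AddSubmonoidClass.coe_finsetSum]
    refine Finset.sum_congr rfl fun n hn => ?_
    rw [h, if_pos (Finset.mem_range.1 hn), coe_ofPolynomial_eq_phiTerm]
  · intro n hn
    by_contra hlt
    refine hn (Subtype.ext ?_)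
    dsimp only
    rw [h, if_neg (by simpa using hlt)]
    simp [Tate.ofPolynomial]

theorem Tate.norm_le {f : Tate Fq} {A : ℝ} (h : ∀ i, ‖PowerSeries.coeff i f.1‖ ≤ A) : ‖f‖ ≤ A := by
  rw [Tate.norm_eq]
  exact ciSup_le h

/-- The ultrametric tail estimate is uniform in the coefficient index, so the coefficientwise sum is
the limit in Gauss norm, and `limUnder` in `phiMap` is a genuine limit. -/
theorem tendsto_phiTilde_trunc (hr : 1 ≤ r) (hk : ∀ i, 1 ≤ i → i ≤ r → ‖k i‖ ≤ 1)
    (hkr : ‖k r‖ = 1) (hkt : ∀ i, twist i (k r) = k r) (a : MM Fq r) :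
    ∃ S : Fin r → Tate Fq, (∀ j, (S j).1 = coeffSum (phiTerm r k a j)) ∧
      Tendsto (fun N => phiTilde r k (MM.trunc N a)) atTop (𝓝 S) := by
  have hg (j : Fin r) := gaussBound_phiTerm hr hk hkr hkt a j
  have hc := a.2
  have hres (j : Fin r) : PowerSeries.IsRestricted 1 (coeffSum (phiTerm r k a j)) := by
    rw [PowerSeries.isRestricted_iff']
    refine squeeze_zero (fun l => by positivity) (fun l => ?_)
      (GaussBound.tendsto_coeffSum (hg j) hc (eventually_coeff_phiTerm a j))
    rw [one_pow]
    gcongr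
    exact one_le_pow₀ one_lt_card_real.le
  refine ⟨fun j => ⟨_, hres j⟩, fun j => rfl, tendsto_pi_nhds.2 fun j => ?_⟩
  rw [Metric.tendsto_atTop]
  intro ε hε
  obtain ⟨N, hN⟩ := eventually_atTop.1 (hc.eventually (gt_mem_nhds (half_pos hε)))
  refine ⟨N, fun M hM => ?_⟩
  rw [dist_comm, dist_eq_norm]
  refine (Tate.norm_le fun l => ?_).trans_lt (half_lt_self hε)
  have h := GaussBound.coeffSum_sub (hg j) hc (half_pos hε).le
    (fun n hn => (hN n (le_trans hM hn)).le)
  rw [← coe_phiTilde_trunc] at h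
  exact h.norm_coeff_le l

theorem coe_phiMap (hr : 1 ≤ r) (hk : ∀ i, 1 ≤ i → i ≤ r → ‖k i‖ ≤ 1)
    (hkr : ‖k r‖ = 1) (hkt : ∀ i, twist i (k r) = k r) (a : MM Fq r) (j : Fin r) :
    (phiMap r k a j).1 = coeffSum (phiTerm r k a j) := by
  obtain ⟨S, hS, h⟩ := tendsto_phiTilde_trunc hr hk hkr hkt a
  rw [phiMap, h.limUnder_eq, hS]

theorem phiMap_add (hr : 1 ≤ r) (hk : ∀ i, 1 ≤ i → i ≤ r → ‖k i‖ ≤ 1)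
    (hkr : ‖k r‖ = 1) (hkt : ∀ i, twist i (k r) = k r) (a b : MM Fq r) :
    phiMap r k (a + b) = phiMap r k a + phiMap r k b := by
  refine funext fun j => Subtype.ext (PowerSeries.ext fun l => ?_)
  have h (a : MM Fq r) := GaussBound.summable_coeff (gaussBound_phiTerm hr hk hkr hkt a j) a.2 l
  rw [Pi.add_apply, Subring.coe_add, map_add]
  simp only [coe_phiMap hr hk hkr hkt, coeffSum, PowerSeries.coeff_mk]
  rw [← (h a).tsum_add (h b)]
  refine tsum_congr fun n => ?_
  have : (a + b).1.coeff n = a.1.coeff n + b.1.coeff n := rfl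
  simp only [phiTerm, PowerSeries.coeff_C_mul, this]
  ring

theorem norm_phiMap_le (hr : 1 ≤ r) (hk : ∀ i, 1 ≤ i → i ≤ r → ‖k i‖ ≤ 1)
    (hkr : ‖k r‖ = 1) (hkt : ∀ i, twist i (k r) = k r) (a : MM Fq r) :
    ‖phiMap r k a‖ ≤ ‖a‖ := by
  refine (pi_norm_le_iff_of_nonneg (norm_nonneg _)).2 fun j => Tate.norm_le fun l => ?_
  rw [coe_phiMap hr hk hkr hkt]
  refine (GaussBound.coeffSum (gaussBound_phiTerm hr hk hkr hkt a j) a.2 (norm_nonneg a)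
    fun n => ?_).norm_coeff_le l
  exact le_ciSup (MM.bddAbove a) n

theorem continuous_phiMap (hr : 1 ≤ r) (hk : ∀ i, 1 ≤ i → i ≤ r → ‖k i‖ ≤ 1)
    (hkr : ‖k r‖ = 1) (hkt : ∀ i, twist i (k r) = k r) : Continuous (phiMap r k) := by
  refine AddMonoidHomClass.continuous_of_bound
    (AddMonoidHom.mk' (phiMap r k) (phiMap_add hr hk hkr hkt)) 1 fun a => ?_
  rw [one_mul]
  exact norm_phiMap_le hr hk hkr hkt a

theorem phiMap_eq_phiTilde {a : MM Fq r} (ha : a ∈ Mphi Fq r) :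
    phiMap r k a = phiTilde r k a := by
  obtain ⟨N, hN⟩ := ha
  refine Tendsto.limUnder_eq (tendsto_const_nhds.congr' ?_)
  filter_upwards [eventually_ge_atTop N] with M hM
  congr 1
  refine Subtype.ext (TauSeries.ext fun n => ?_)
  change _ = if n < M then a.1.coeff n else 0
  split_ifs with h
  · rfl
  · exact hN n (by omega)

end PhiMap

/-! ### Injectivity of `φ` -/

section Injectivity

open scoped PowerSeries.WithPiTopology

variable {r : ℕ} {k : ℕ → CInfty Fq}

/-- In the coefficientwise topology, multiplication by an arbitrary fixed power series is
continuous. Algebraic identities for the terms therefore pass to φ(a) without further growth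
estimates. -/
theorem hasSum_phiMap (hr : 1 ≤ r) (hk : ∀ i, 1 ≤ i → i ≤ r → ‖k i‖ ≤ 1)
    (hkr : ‖k r‖ = 1) (hkt : ∀ i, twist i (k r) = k r) (a : MM Fq r) (j : Fin r) :
    HasSum (phiTerm r k a j) (phiMap r k a j).1 := by
  rw [PowerSeries.WithPiTopology.hasSum_iff_hasSum_coeff]
  intro l
  rw [coe_phiMap hr hk hkr hkt, coeffSum, PowerSeries.coeff_mk]
  exact (GaussBound.summable_coeff (gaussBound_phiTerm hr hk hkr hkt a j) a.2 l).hasSum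

theorem hasSum_twistPS {ι : Type*} {g : ι → (CInfty Fq)⟦X⟧} {S : (CInfty Fq)⟦X⟧}
    (h : HasSum g S) : HasSum (fun n => twistPS 1 (g n)) (twistPS 1 S) := by
  rw [PowerSeries.WithPiTopology.hasSum_iff_hasSum_coeff] at h ⊢
  intro l
  simp only [coeff_twistPS, twist_one]
  have hc : Continuous (frob Fq) := by simpa using continuous_frob_pow (Fq := Fq) 1
  exact (h l).map (frob Fq) hc

/-- The series `∑ a_{n+1}^{(-1)} τⁿ`. -/
def MM.shift (a : MM Fq r) : MM Fq r :=
  ⟨fun n => twist (-1) (a.1.coeff (n + 1)), by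
    have ha := (tendsto_add_atTop_iff_nat 1).2 a.2
    refine Metric.tendsto_atTop.2 fun ε hε => ?_
    -- The n-th weighted coefficient of the shift, raised to the power q, is the (n+1)-st weighted
    -- coefficient of a; hence the threshold ε^q.
    obtain ⟨N, hN⟩ := Metric.tendsto_atTop.1 ha (ε ^ qF) (by positivity)
    refine ⟨N, fun n hn => ?_⟩
    have hv := frakV_pos (Fq := Fq) r
    have h := hN n hn
    rw [dist_zero_right, Real.norm_of_nonneg (by positivity)] at h ⊢
    refine lt_of_pow_lt_pow_left₀ qF hε.le (lt_of_eq_of_lt ?_ h)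
    change (‖twist (-1) (a.1.coeff (n + 1))‖ * _) ^ _ = _
    rw [mul_pow, ← pow_mul, ← pow_succ, ← norm_pow, ← frob_apply, ← twist_one, twist_twist,
      add_neg_cancel, twist_zero]⟩

theorem MM.coeff_shift (a : MM Fq r) (n : ℕ) :
    (MM.shift a).1.coeff n = twist (-1) (a.1.coeff (n + 1)) := rfl

/-- This is a = a₀ + τ · `MM.shift a` seen through φ: left multiplication by τ becomes x ↦ x^{(1)}
Φᵗʳ, since k_r is fixed by twists. -/
theorem phiMap_eq_shift (hr : 1 ≤ r) (hk : ∀ i, 1 ≤ i → i ≤ r → ‖k i‖ ≤ 1)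
    (hkr : ‖k r‖ = 1) (hkt : ∀ i, twist i (k r) = k r) (a : MM Fq r) (j : Fin r) :
    (phiMap r k a j).1 = PowerSeries.C ((k r)⁻¹ * a.1.coeff 0) * rowSeries r k 0 j +
      ∑ i, twistPS 1 (phiMap r k (MM.shift a) i).1 * (PhiMat r k j i : (CInfty Fq)⟦X⟧) := by
  refine (hasSum_phiMap hr hk hkr hkt a j).unique (HasSum.zero_add (f := phiTerm r k a j) ?_)
  have h : HasSum (fun n => ∑ i, twistPS 1 (phiTerm r k (MM.shift a) i n) *
      (PhiMat r k j i : (CInfty Fq)⟦X⟧)) (∑ i, twistPS 1 (phiMap r k (MM.shift a) i).1 *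
      (PhiMat r k j i : (CInfty Fq)⟦X⟧)) :=
    hasSum_sum fun i _ => (hasSum_twistPS (hasSum_phiMap hr hk hkr hkt (MM.shift a) i)).mul_right _
  refine h.congr_fun fun n => ?_
  rw [phiTerm, rowSeries_succ, Finset.mul_sum]
  refine Finset.sum_congr rfl fun i _ => ?_
  rw [phiTerm, map_mul (twistPS 1), twistPS_C, map_mul (twist 1), map_inv₀, hkt, MM.coeff_shift, twist_twist,
    add_neg_cancel, twist_zero, mul_assoc]

theorem twistPS_injective (i : ℤ) : Function.Injective (twistPS (Fq := Fq) i) :=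
  Function.LeftInverse.injective (g := twistPS (-i)) fun f => by
    rw [twistPS_twistPS, neg_add_cancel, twistPS_zero]

theorem tendsto_coeff_phiMap (hr : 1 ≤ r) (hk : ∀ i, 1 ≤ i → i ≤ r → ‖k i‖ ≤ 1)
    (hkr : ‖k r‖ = 1) (hkt : ∀ i, twist i (k r) = k r) (a : MM Fq r) (j : Fin r) :
    Tendsto (fun l => ‖PowerSeries.coeff l (phiMap r k a j).1‖ * (qF : ℝ) ^ l) atTop (𝓝 0) := by
  rw [coe_phiMap hr hk hkr hkt]
  exact GaussBound.tendsto_coeffSum (gaussBound_phiTerm hr hk hkr hkt a j) a.2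
    (eventually_coeff_phiTerm a j)

/-- A power series converging on the disc of radius `q` cannot be a nonzero multiple of
`(t - θ)⁻¹`. -/
theorem eq_zero_of_mul_X_sub_theta_eq_C {u : (CInfty Fq)⟦X⟧} {c : CInfty Fq}
    (hu : Tendsto (fun l => ‖PowerSeries.coeff l u‖ * (qF : ℝ) ^ l) atTop (𝓝 0))
    (h : u * (PowerSeries.X - PowerSeries.C (theta Fq)) = PowerSeries.C c) : u = 0 := by
  -- Above the constant term the equation reads c_l = θ c_{l+1}, so the weighted norm |c_l| q^l
  -- never changes, whereas it must tend to 0.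
  have hconst (l : ℕ) : ‖PowerSeries.coeff l u‖ * (qF : ℝ) ^ l = ‖PowerSeries.coeff 0 u‖ := by
    induction l with
    | zero => simp
    | succ l ih =>
      have hl := congrArg (PowerSeries.coeff (l + 1)) h
      rw [mul_sub, map_sub, PowerSeries.coeff_succ_mul_X, PowerSeries.coeff_mul_C,
        PowerSeries.coeff_C, if_neg (by omega), sub_eq_zero] at hl
      rw [← ih, hl, norm_mul, norm_theta]
      ring
  simp only [hconst, tendsto_const_nhds_iff] at hu
  ext l
  have := hconst l
  rw [hu, mul_eq_zero, norm_eq_zero] at this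
  exact this.resolve_right (pow_ne_zero _ (by exact_mod_cast Fintype.card_ne_zero))

/-- All entries but the last in the shift relation kill the components of index ≠ 0. The last one
then leaves u (t - θ) = -a₀ for the twisted component u of index 0, and u converges on the disc of
radius q. -/
theorem phiMap_shift_eq_zero (hr : 1 ≤ r) (hk : ∀ i, 1 ≤ i → i ≤ r → ‖k i‖ ≤ 1)
    (hkr : ‖k r‖ = 1) (hkt : ∀ i, twist i (k r) = k r) {a : MM Fq r} (ha : phiMap r k a = 0) :
    a.1.coeff 0 = 0 ∧ phiMap r k (MM.shift a) = 0 := by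
  have hkr0 : k r ≠ 0 := by
    rw [← norm_pos_iff, hkr]
    exact one_pos
  have hid (j : Fin r) := phiMap_eq_shift hr hk hkr hkt a j
  simp only [ha, Pi.zero_apply, ZeroMemClass.coe_zero] at hid
  have hpos (i : Fin r) (hi : i.1 ≠ 0) : twistPS 1 (phiMap r k (MM.shift a) i).1 = 0 := by
    obtain ⟨m | m, hm⟩ := i
    · exact absurd rfl hi
    have h := hid ⟨m, by omega⟩
    simp only [PhiMat_coe_of_lt (j := ⟨m, by omega⟩) hm, rowSeries_zero, if_neg hm.ne, mul_zero,
      zero_add, mul_ite, mul_one, Finset.sum_ite_eq', Finset.mem_univ, if_true] at h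
    exact h.symm
  have h := hid ⟨r - 1, by omega⟩
  have hl : r - 1 + 1 = r := by omega
  rw [Finset.sum_eq_single ⟨0, by omega⟩ (fun i _ hi => by
      rw [hpos i fun h => hi (Fin.ext h), zero_mul]) (by simp),
    PhiMat_coe_last_zero hl rfl, rowSeries_zero, if_pos hl, mul_one, hkt] at h
  set u := twistPS 1 (phiMap r k (MM.shift a) ⟨0, by omega⟩).1 with hu
  have hmul : u * (PowerSeries.X - PowerSeries.C (theta Fq)) = PowerSeries.C (-a.1.coeff 0) := by
    have h2 : PowerSeries.C (k r) * PowerSeries.C (k r)⁻¹ = (1 : (CInfty Fq)⟦X⟧) := by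
      rw [← map_mul, mul_inv_cancel₀ hkr0, map_one]
    rw [map_mul] at h
    rw [map_neg]
    linear_combination -(PowerSeries.C (k r)) * h + (PowerSeries.C (a.1.coeff 0) +
      u * (PowerSeries.X - PowerSeries.C (theta Fq))) * (-h2)
  have hu0 : u = 0 := by
    refine eq_zero_of_mul_X_sub_theta_eq_C ?_ hmul
    have ht := (tendsto_coeff_phiMap hr hk hkr hkt (MM.shift a) ⟨0, by omega⟩).pow qF
    rw [zero_pow Fintype.card_ne_zero] at ht
    refine squeeze_zero (fun l => by positivity) (fun l => ?_) ht
    rw [hu, coeff_twistPS, twist_one, frob_apply, norm_pow, mul_pow]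
    gcongr
    exact le_self_pow₀ (one_le_pow₀ one_lt_card_real.le) Fintype.card_ne_zero
  refine ⟨?_, funext fun i => Subtype.ext (twistPS_injective 1 ?_)⟩
  · have := congrArg (PowerSeries.coeff 0) hmul
    rw [hu0, zero_mul, map_zero, PowerSeries.coeff_C, if_pos rfl] at this
    exact neg_eq_zero.1 this.symm
  · rw [Pi.zero_apply, ZeroMemClass.coe_zero, map_zero]
    by_cases hi : i.1 = 0
    · rw [← hu0, hu]
      congr 3
      exact Fin.ext hi
    · exact hpos i hi

theorem phiMap_injective (hr : 1 ≤ r) (hk : ∀ i, 1 ≤ i → i ≤ r → ‖k i‖ ≤ 1)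
    (hkr : ‖k r‖ = 1) (hkt : ∀ i, twist i (k r) = k r) : Function.Injective (phiMap r k) := by
  have key (n : ℕ) : ∀ a : MM Fq r, phiMap r k a = 0 → a.1.coeff n = 0 := by
    induction n with
    | zero => exact fun a ha => (phiMap_shift_eq_zero hr hk hkr hkt ha).1
    | succ n ih =>
      intro a ha
      have h := ih _ (phiMap_shift_eq_zero hr hk hkr hkt ha).2
      rw [MM.coeff_shift] at h
      exact (map_eq_zero _).1 h
  refine (injective_iff_map_eq_zero
    (AddMonoidHom.mk' (phiMap r k) (phiMap_add hr hk hkr hkt))).2 fun a ha => ?_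
  exact Subtype.ext (TauSeries.ext fun n => key n a ha)

end Injectivity

/-! ### The logarithm as a preimage -/

section LogFormula

open scoped PowerSeries.WithPiTopology

variable {r : ℕ} {k : ℕ → CInfty Fq}

/-- The series `∑_l k_{l+s+1}^{(-(s+1))} f^{(l)}`; for an Anderson generating function `f` of a
period, these are the entries of a column of `(Vᵗʳ)^{(-1)} Υ`. -/
def adjointSeries (r : ℕ) (k : ℕ → CInfty Fq) (f : (CInfty Fq)⟦X⟧) (s : ℕ) : (CInfty Fq)⟦X⟧ :=
  ∑ l ∈ Finset.range (r - s),
    PowerSeries.C (twist (-((s + 1 : ℕ) : ℤ)) (k (l + s + 1))) * twistPS l f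

theorem adjointSeries_last (hkt : ∀ i, twist i (k r) = k r) (f : (CInfty Fq)⟦X⟧)
    {s : ℕ} (hs : s + 1 = r) : adjointSeries r k f s = PowerSeries.C (k r) * f := by
  rw [adjointSeries, show r - s = 1 by omega, Finset.sum_range_one, zero_add, hs, hkt,
    Nat.cast_zero, twistPS_zero]

theorem twistPS_adjointSeries (f : (CInfty Fq)⟦X⟧) (s : ℕ) :
    twistPS 1 (adjointSeries r k f s) = ∑ l ∈ Finset.range (r - s),
      PowerSeries.C (twist (-(s : ℤ)) (k (l + s + 1))) * twistPS ((l + 1 : ℕ) : ℤ) f := by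
  rw [adjointSeries, map_sum]
  refine Finset.sum_congr rfl fun l _ => ?_
  rw [map_mul, twistPS_C, twistPS_twistPS, twist_twist]
  congr 3
  · push_cast
    ring_nf
  · push_cast
    ring

theorem adjointSeries_eq_add {s : ℕ} (hs : s + 1 < r) (f : (CInfty Fq)⟦X⟧) :
    adjointSeries r k f s = PowerSeries.C (twist (-((s + 1 : ℕ) : ℤ)) (k (s + 1))) * f +
      twistPS 1 (adjointSeries r k f (s + 1)) := by
  rw [twistPS_adjointSeries, adjointSeries, show r - s = r - (s + 1) + 1 by omega,
    Finset.sum_range_succ', add_comm, zero_add, Nat.cast_zero, twistPS_zero]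
  congr 1
  refine Finset.sum_congr rfl fun l _ => ?_
  rw [show l + 1 + s + 1 = l + (s + 1) + 1 by ring]

/-- The column of series `adjointSeries` is turned into its Frobenius twist by `Φᵗʳ`. -/
theorem sum_PhiMat_mul_adjointSeries (hr : 1 ≤ r) (hkr : k r ≠ 0)
    (hkt : ∀ i, twist i (k r) = k r) {f : (CInfty Fq)⟦X⟧}
    (hf : (PowerSeries.X - PowerSeries.C (theta Fq)) * f =
      ∑ i ∈ Finset.Icc 1 r, PowerSeries.C (k i) * twistPS i f) (i : Fin r) :
    ∑ j, (PhiMat r k j i : (CInfty Fq)⟦X⟧) * adjointSeries r k f j.1 =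
      twistPS 1 (adjointSeries r k f i.1) := by
  obtain ⟨n, rfl⟩ := Nat.exists_eq_add_of_le' hr
  have hC : PowerSeries.C (k (n + 1))⁻¹ * PowerSeries.C (k (n + 1)) = (1 : (CInfty Fq)⟦X⟧) := by
    rw [← map_mul, inv_mul_cancel₀ hkr, map_one]
  rw [Fin.sum_univ_castSucc,
    adjointSeries_last hkt f (s := (Fin.last n).1) (by simp)]
  -- Column 0 of Φ meets only the last row, where t - θ brings in the functional equation. Column
  -- m+1 meets row m and the last row, whose entry cancels the extra summand of
  -- `adjointSeries_eq_add`.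
  obtain ⟨m | m, hm⟩ := i
  · rw [Finset.sum_eq_zero, zero_add, PhiMat_coe_last_zero (by simp) rfl, hkt,
      twistPS_adjointSeries]
    · have h1 : PowerSeries.C (k (n + 1))⁻¹ * (PowerSeries.X - PowerSeries.C (theta Fq)) *
          (PowerSeries.C (k (n + 1)) * f) = (PowerSeries.X - PowerSeries.C (theta Fq)) * f := by
        linear_combination ((PowerSeries.X - PowerSeries.C (theta Fq)) * f) * hC
      rw [h1, hf, Nat.cast_zero, neg_zero, Nat.sub_zero, Finset.range_eq_Ico]
      simp only [twist_zero, add_zero]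
      rw [Finset.sum_Ico_add' (fun i => PowerSeries.C (k i) * twistPS (i : ℤ) f)]
      exact Finset.sum_congr (by ext; simp) fun _ _ => rfl
    · intro j _
      have hj : (Fin.castSucc j).1 + 1 < n + 1 := by simp
      rw [PhiMat_coe_of_lt hj, if_neg (by simp [Fin.ext_iff]), zero_mul]
  · rw [Finset.sum_eq_single ⟨m, by omega⟩]
    · rw [PhiMat_coe_of_lt (j := Fin.castSucc ⟨m, by omega⟩) hm, if_pos (by simp), one_mul,
        PhiMat_coe_last (by simp) (by simp), hkt]
      have h := adjointSeries_eq_add (k := k) hm f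
      simp only [Fin.val_castSucc] at h ⊢
      rw [h, div_eq_mul_inv, map_mul, map_neg]
      linear_combination
        (-PowerSeries.C (twist (-((m + 1 : ℕ) : ℤ)) (k (m + 1))) * f) * hC
    · intro j _ hj
      have hj' : (Fin.castSucc j).1 + 1 < n + 1 := by simp
      rw [PhiMat_coe_of_lt hj', if_neg, zero_mul]
      intro h
      refine hj (Fin.ext ?_)
      have := congrArg Fin.val h
      simp only [Fin.val_castSucc] at this
      simp only
      omega
    · simp

/-- Row 0 selects the last component k_r f. Passing to row n+1 twists the whole pairing, because the
factor Φᵗʳ is absorbed by the column. -/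
theorem sum_rowSeries_mul_adjointSeries (hr : 1 ≤ r) (hkr : k r ≠ 0)
    (hkt : ∀ i, twist i (k r) = k r) {f : (CInfty Fq)⟦X⟧}
    (hf : (PowerSeries.X - PowerSeries.C (theta Fq)) * f =
      ∑ i ∈ Finset.Icc 1 r, PowerSeries.C (k i) * twistPS i f) (n : ℕ) :
    ∑ j, rowSeries r k n j * adjointSeries r k f j.1 = PowerSeries.C (k r) * twistPS n f := by
  induction n with
  | zero =>
    simp only [rowSeries_zero]
    rw [Finset.sum_eq_single ⟨r - 1, by omega⟩]
    · rw [if_pos (by simp only; omega), one_mul,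
        adjointSeries_last hkt f (by simp only; omega), Nat.cast_zero, twistPS_zero]
    · intro j _ hj
      rw [if_neg fun h => hj (Fin.ext (by simp only; omega)), zero_mul]
    · simp
  | succ n ih =>
    have h := congrArg (twistPS 1) ih
    rw [map_sum, map_mul, twistPS_C, hkt, twistPS_twistPS] at h
    rw [Nat.cast_succ, add_comm (n : ℤ), ← h]
    simp only [rowSeries_succ, Finset.sum_mul]
    rw [Finset.sum_comm]
    refine Finset.sum_congr rfl fun i _ => ?_
    rw [map_mul, ← sum_PhiMat_mul_adjointSeries hr hkr hkt hf i, Finset.mul_sum]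
    exact Finset.sum_congr rfl fun j _ => mul_assoc _ _ _

variable (k) in
/-- The logarithm series as an element of `𝕄`. -/
def logMM (hr : 1 ≤ r) (hk : ∀ i, 1 ≤ i → i ≤ r → ‖k i‖ ≤ 1) : MM Fq r :=
  ⟨logSeries r k, by
    have hR := zero_lt_one.trans (one_lt_logRadius (Fq := Fq) hr)
    have hv := frakV_pos (Fq := Fq) r
    -- Here 𝔳 = s^(q^(r-1)) is smaller than R = s^(q^r), so the coefficient bound on log_φ gives
    -- decay in 𝕄.
    have hlt : frakV Fq r / logRadius Fq r < 1 := by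
      rw [div_lt_one hR, frakV_eq, ← torsionRadius_pow hr]
      exact pow_lt_pow_right₀ (one_lt_torsionRadius hr)
        (Nat.pow_lt_pow_right Fintype.one_lt_card (by omega))
    have h := (tendsto_pow_atTop_nhds_zero_of_lt_one (by positivity) hlt).const_mul
      (logRadius Fq r)
    rw [mul_zero] at h
    refine squeeze_zero (fun n => by positivity) (fun n => ?_) h
    calc ‖(logSeries r k).coeff n‖ * frakV Fq r ^ qF ^ n
        = ‖(logSeries r k).coeff n‖ * logRadius Fq r ^ qF ^ n *
          (frakV Fq r / logRadius Fq r) ^ qF ^ n := by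
          rw [div_pow]
          field_simp
      _ ≤ logRadius Fq r * (frakV Fq r / logRadius Fq r) ^ n := by
          refine mul_le_mul ?_ ?_ (by positivity) hR.le
          · simpa using coeffBound_logSeries hr hk n
          · exact pow_le_pow_of_le_one (by positivity) hlt.le (le_card_pow n)⟩

theorem sum_phiMap_log_mul_adjointSeries (hr : 1 ≤ r) (hk : ∀ i, 1 ≤ i → i ≤ r → ‖k i‖ ≤ 1)
    (hkr : ‖k r‖ = 1) (hkt : ∀ i, twist i (k r) = k r) {ξ : CInfty Fq}
    (hξ : ξ ∈ thetaTorsion r k) :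
    (∑ j, (phiMap r k (logMM k hr hk) j).1 *
      adjointSeries r k (agf r k (fundPeriod r k ξ)) j.1) *
      (PowerSeries.X - PowerSeries.C (theta Fq)) = -PowerSeries.C (fundPeriod r k ξ) := by
  have hkr0 : k r ≠ 0 := by
    rw [← norm_pos_iff, hkr]
    exact one_pos
  have hlt := (norm_le_torsionRadius hr hk hkr hξ).trans_lt (torsionRadius_lt_logRadius hr)
  set f := agf r k (fundPeriod r k ξ) with hfdef
  have hf := agf_functional_equation hr hk hlt hξ
  have hsum : HasSum (fun n => PowerSeries.C ((logSeries r k).coeff n) * twistPS n f)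
      (∑ j, (phiMap r k (logMM k hr hk) j).1 * adjointSeries r k f j.1) := by
    have h : HasSum (fun n => ∑ j, phiTerm r k (logMM k hr hk) j n * adjointSeries r k f j.1)
        (∑ j, (phiMap r k (logMM k hr hk) j).1 * adjointSeries r k f j.1) :=
      hasSum_sum fun j _ => (hasSum_phiMap hr hk hkr hkt _ j).mul_right _
    refine h.congr_fun fun n => ?_
    simp only [phiTerm, mul_assoc, ← Finset.mul_sum]
    rw [sum_rowSeries_mul_adjointSeries hr hkr0 hkt hf, ← mul_assoc, ← map_mul, mul_right_comm,
      inv_mul_cancel₀ hkr0, one_mul]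
    rfl
  -- The coefficient of t^l in ∑ βₙ f^{(n)} is log_φ evaluated at the l-th division point, where
  -- log_φ undoes exp_φ.
  have hcoeff (l : ℕ) : PowerSeries.coeff l
      (∑ j, (phiMap r k (logMM k hr hk) j).1 * adjointSeries r k f j.1) =
      evalAt (logSeries r k) ξ / theta Fq ^ l := by
    have h := ((PowerSeries.WithPiTopology.hasSum_iff_hasSum_coeff _).1 hsum l).tsum_eq
    rw [← h, ← evalAt_logSeries_divisionPoint hr hk hlt l, evalAt]
    refine tsum_congr fun n => ?_
    rw [PowerSeries.coeff_C_mul, coeff_twistPS, twist_natCast, frob_pow_apply, hfdef,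
      coeff_agf_fundPeriod]
  have hθ := theta_ne_zero (Fq := Fq)
  ext l
  rw [mul_sub, map_sub, PowerSeries.coeff_mul_C, hcoeff, map_neg, PowerSeries.coeff_C]
  rcases l with - | l
  · rw [PowerSeries.coeff_zero_mul_X, if_pos rfl, fundPeriod]
    ring
  · rw [PowerSeries.coeff_succ_mul_X, hcoeff, if_neg (by omega), pow_succ]
    field_simp
    ring

/-- Reversing the columns makes V upper triangular, with twists of k_r on the diagonal. -/
theorem isUnit_det_VMat (hkr : k r ≠ 0) (hkt : ∀ i, twist i (k r) = k r) :
    IsUnit (VMat r k).det := by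
  have htri : ((VMat r k).submatrix id (Fin.revPerm : Equiv.Perm (Fin r))).BlockTriangular id := by
    intro i j hij
    have hij : j.1 < i.1 := hij
    simp only [VMat, Matrix.submatrix_apply, Matrix.of_apply, id, Fin.revPerm_apply, Fin.val_rev]
    exact if_neg (by omega)
  have h := Matrix.det_permute' (Fin.revPerm : Equiv.Perm (Fin r)) (VMat r k)
  rw [Matrix.det_of_isUpperTriangular htri] at h
  refine isUnit_iff_ne_zero.2 fun h0 => ?_
  rw [h0, mul_zero, Finset.prod_eq_zero_iff] at h
  obtain ⟨i, -, hi⟩ := h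
  simp only [VMat, Matrix.submatrix_apply, Matrix.of_apply, id, Fin.revPerm_apply,
    Fin.val_rev] at hi
  rw [if_pos (by omega), show i.1 + (r - (i.1 + 1)) + 1 = r by omega, hkt] at hi
  exact hkr hi

theorem Psi_inverse {lam : Fin r → CInfty Fq} (hV : IsUnit (VMat r k).det)
    (hU : IsUnit (Upsilon r k lam).det) :
    (Matrix.of fun s j : Fin r => adjointSeries r k (agf r k (lam j)) s.1) *
      (Psi r k lam)ᵀ.map (twistPS (-1)) = 1 := by
  set Y := (Upsilon r k lam).map (twistPS 1) with hY
  have hYdet : IsUnit Yᵀ.det := by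
    rw [Matrix.det_transpose]
    have h := hU.map (twistPS (Fq := Fq) 1)
    rwa [RingHom.map_det] at h
  have h1 : Yᵀ * (VMat r k).map PowerSeries.C * Psi r k lam = 1 := by
    rw [Psi, Matrix.mul_assoc, ← Matrix.mul_assoc (Matrix.map _ _), ← Matrix.map_mul,
      Matrix.mul_nonsing_inv _ hV, Matrix.map_one _ (map_zero _) (map_one _), Matrix.one_mul,
      Matrix.mul_nonsing_inv _ hYdet]
  have h2 := congrArg (fun M => Mᵀ.map (twistPS (-1))) h1
  simp only [Matrix.transpose_mul, Matrix.transpose_transpose, Matrix.map_mul,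
    Matrix.transpose_one, Matrix.map_one _ (map_zero (twistPS (-1))) (map_one (twistPS (-1)))] at h2
  -- Transposing and untwisting (Υ^{(1)})ᵗʳ V Ψ = 1 puts the Ψ factor on the left. It remains to
  -- recognize the entries of (Vᵗʳ)^{(-1)} Υ as `adjointSeries`; the zeros of V cut the sum at r -
  -- s.
  rw [mul_eq_one_comm, ← h2]
  congr 1
  ext1 s j
  rw [Matrix.of_apply, Matrix.mul_apply, adjointSeries]
  have hterm (i : Fin r) : ((VMat r k).map PowerSeries.C)ᵀ.map (twistPS (-1)) s i *
      Y.map (twistPS (-1)) i j = if i.1 < r - s.1 then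
        PowerSeries.C (twist (-((s.1 + 1 : ℕ) : ℤ)) (k (i.1 + s.1 + 1))) *
          twistPS (i.1 : ℤ) (agf r k (lam j)) else 0 := by
    simp only [Matrix.map_apply, Matrix.transpose_apply, hY, twistPS_twistPS, neg_add_cancel_left,
      twistPS_C, VMat, Upsilon, Matrix.of_apply]
    by_cases h : i.1 + s.1 + 1 ≤ r
    · rw [if_pos h, if_pos (by omega), twist_twist]
      congr 4
      push_cast
      ring
    · rw [if_neg h, if_neg (by omega), map_zero, map_zero, zero_mul]
  simp only [hterm]
  rw [Fin.sum_univ_eq_sum_range (fun i => if i < r - s.1 then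
      PowerSeries.C (twist (-((s.1 + 1 : ℕ) : ℤ)) (k (i + s.1 + 1))) *
        twistPS (i : ℤ) (agf r k (lam j)) else 0) r, ← Finset.sum_filter]
  refine Finset.sum_congr ?_ fun _ _ => rfl
  ext i
  simp only [Finset.mem_range, Finset.mem_filter]
  omega

theorem coe_phiMap_log (hr : 1 ≤ r) (hk : ∀ i, 1 ≤ i → i ≤ r → ‖k i‖ ≤ 1)
    (hkr : ‖k r‖ = 1) (hkt : ∀ i, twist i (k r) = k r) {ξ lam : Fin r → CInfty Fq}
    (hξ : ∀ j, ξ j ∈ thetaTorsion r k) (hli : LinearIndependent Fq ξ)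
    (hlam : ∀ j, lam j = fundPeriod r k (ξ j)) (j : Fin r) :
    (phiMap r k (logMM k hr hk) j).1 = logVector r k lam j := by
  have hkr0 : k r ≠ 0 := by
    rw [← norm_pos_iff, hkr]
    exact one_pos
  set x : Fin r → (CInfty Fq)⟦X⟧ := fun j => (phiMap r k (logMM k hr hk) j).1 with hx
  set A : Matrix (Fin r) (Fin r) (CInfty Fq)⟦X⟧ :=
    Matrix.of fun s j : Fin r => adjointSeries r k (agf r k (lam j)) s.1 with hA
  have hAB := Psi_inverse (isUnit_det_VMat hkr0 hkt) (isUnit_det_Upsilon hr hk hkr hξ hli hlam)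
  have hX : (PowerSeries.X - PowerSeries.C (theta Fq))⁻¹ *
      (PowerSeries.X - PowerSeries.C (theta Fq)) = 1 :=
    PowerSeries.inv_mul_cancel _ (by simpa using theta_ne_zero)
  have hxA : x ᵥ* A = (-(PowerSeries.X - PowerSeries.C (theta Fq))⁻¹) •
      fun i => PowerSeries.C (lam i) := by
    funext i
    have h := sum_phiMap_log_mul_adjointSeries hr hk hkr hkt (hξ i)
    rw [← hlam] at h
    change (x ᵥ* A) i * _ = _ at h
    rw [Pi.smul_apply, smul_eq_mul]
    linear_combination (PowerSeries.X - PowerSeries.C (theta Fq))⁻¹ * h - (x ᵥ* A) i * hX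
  have hfin : x = logVector r k lam := by
    rw [logVector, ← Matrix.smul_vecMul, ← hxA, Matrix.vecMul_vecMul, hAB, Matrix.vecMul_one]
  exact congrFun hfin j

end LogFormula

end DrinfeldLog

end

/-! ### The main theorem -/

theorem theorem1p1 {Fq : Type*} [Field Fq] [Fintype Fq] (r : ℕ) (hr : 1 ≤ r)
    (k : ℕ → DrinfeldLog.CInfty Fq)
    (hk : ∀ i, 1 ≤ i → i < r → ‖k i‖ ≤ 1)
    (hkr : ∃ c : Fq, c ≠ 0 ∧ k r = algebraMap Fq (DrinfeldLog.CInfty Fq) c)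
    (ξ : Module.Basis (Fin r) Fq (DrinfeldLog.thetaTorsion r k))
    (lam : Fin r → DrinfeldLog.CInfty Fq)
    (hlam : ∀ i, lam i = DrinfeldLog.fundPeriod r k (ξ i)) :
    -- the fundamental periods are defined, and `Υ ∈ GL_r(𝕋)`, so that `Ψ` is defined
    (∀ i, (ξ i : DrinfeldLog.CInfty Fq) ∈ DrinfeldLog.logDomain r k) ∧
    (∃ U : GL (Fin r) (DrinfeldLog.Tate Fq), ∀ i j,
      ((U i j : DrinfeldLog.Tate Fq) : PowerSeries (DrinfeldLog.CInfty Fq)) =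
        DrinfeldLog.Upsilon r k lam i j) ∧
    -- `φ` is a continuous injective extension of `φ̃`, so that `𝓜 = φ⁻¹` is defined on its range
    Continuous (DrinfeldLog.phiMap r k) ∧
    (∀ a ∈ DrinfeldLog.Mphi Fq r, DrinfeldLog.phiMap r k a = DrinfeldLog.phiTilde r k a) ∧
    Function.Injective (DrinfeldLog.phiMap r k) ∧
    -- the two formulas
    ∃ x : Fin r → DrinfeldLog.Tate Fq,
      (∀ i, ((x i : DrinfeldLog.Tate Fq) : PowerSeries (DrinfeldLog.CInfty Fq)) =
        DrinfeldLog.logVector r k lam i) ∧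
      x ∈ Set.range (DrinfeldLog.phiMap r k) ∧
      DrinfeldLog.logSeries r k = DrinfeldLog.calM r k x ∧
      ∀ z ∈ DrinfeldLog.logDomain r k,
        (DrinfeldLog.calM r k x : DrinfeldLog.TauSeries Fq) ∈ DrinfeldLog.domDelta z ∧
        DrinfeldLog.evalAt (DrinfeldLog.logSeries r k) z = DrinfeldLog.calMz r k z x := by
  have hkr' : ‖k r‖ = 1 := by
    obtain ⟨c, hc, h⟩ := hkr
    rw [h, DrinfeldLog.norm_algebraMap_of_ne_zero hc]
  -- The condition k_r ∈ F_q^× enters the argument only through |k_r| = 1 and this invariance under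
  -- twists.
  have hkt (i : ℤ) : DrinfeldLog.twist i (k r) = k r := by
    obtain ⟨c, -, h⟩ := hkr
    rw [h, DrinfeldLog.twist_algebraMap]
  have hk' (i : ℕ) (h1 : 1 ≤ i) (h2 : i ≤ r) : ‖k i‖ ≤ 1 := by
    rcases h2.lt_or_eq with h | rfl
    · exact hk i h1 h
    · exact hkr'.le
  have hR := zero_lt_one.trans (DrinfeldLog.one_lt_logRadius (Fq := Fq) hr)
  have hξ (j : Fin r) : (ξ j : DrinfeldLog.CInfty Fq) ∈ DrinfeldLog.thetaTorsion r k := (ξ j).2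
  have hli : LinearIndependent Fq fun j => (ξ j : DrinfeldLog.CInfty Fq) :=
    ξ.linearIndependent.map' (DrinfeldLog.thetaTorsion r k).subtype (Submodule.ker_subtype _)
  have hinj := DrinfeldLog.phiMap_injective hr hk' hkr' hkt
  have hinv := Function.leftInverse_invFun hinj (DrinfeldLog.logMM k hr hk')
  refine ⟨fun i => ?_, DrinfeldLog.exists_GL_eq_Upsilon hr hk' hkr' hξ hli hlam,
    DrinfeldLog.continuous_phiMap hr hk' hkr' hkt,
    fun a ha => DrinfeldLog.phiMap_eq_phiTilde ha, hinj,
    DrinfeldLog.phiMap r k (DrinfeldLog.logMM k hr hk'),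
    DrinfeldLog.coe_phiMap_log hr hk' hkr' hkt hξ hli hlam, ⟨_, rfl⟩,
    (congrArg Subtype.val hinv).symm, fun z hz => ?_⟩
  · exact (DrinfeldLog.coeffBound_logSeries hr hk').summable hR
      ((DrinfeldLog.norm_le_torsionRadius hr hk' hkr' (hξ i)).trans_lt
        (DrinfeldLog.torsionRadius_lt_logRadius hr))
  · have hz : Summable fun n => (DrinfeldLog.logSeries r k).coeff n * z ^ Fintype.card Fq ^ n := hz
    have hcalM : (DrinfeldLog.calM r k (DrinfeldLog.phiMap r k (DrinfeldLog.logMM k hr hk')) :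
        DrinfeldLog.TauSeries Fq) = DrinfeldLog.logSeries r k := congrArg Subtype.val hinv
    rw [DrinfeldLog.calMz, hcalM]
    refine ⟨hz.tendsto_atTop_zero, ?_⟩
    -- The partial sums in `delta` include the term n = m, hence the shift of the index by one.
    exact (hz.hasSum.tendsto_sum_nat.comp (tendsto_add_atTop_nat 1)).limUnder_eq.symm
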